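/- Let $d,k\ge 2$ be integers with $(d,k)\neq(2,2)$. Let $\sigma$ be the surface measure on the unit sphere $\mathbb S^{d-1}\subset\mathbb R^d$, let $\sigma^k$ be the product measure on $(\mathbb S^{d-1})^k$, and let $\overline{B(k)}\subset\mathbb R^d$ be the closed ball of radius $k$ centered at the origin. Let $f_1,\dots,f_k:\mathbb S^{d-1}\to\mathbb C$ be $\sigma$-measurable functions and let $h:\overline{B(k)}\to\mathbb C$ be a Lebesgue measurable function such that $$f_1(\zeta_1)f_2(\zeta_2)\cdots f_k(\zeta_k)=h(\zeta_1+\zeta_2+\dots+\zeta_k)$$ for $\sigma^k$-a.e. $(\zeta_1,\dots,\zeta_k)\in(\mathbb S^{d-1})^k$. Then one of the following holds: (i) there exist $c_1,\dots,c_k\in\mathbb C\setminus\{0\}$ and $\nu\in\mathbb C^d$ such that, for every $j=1,\dots,k$, $f_j(\zeta)=c_j\,e^{\nu\cdot\zeta}$ for $\sigma$-a.e. $\zeta\in\mathbb S^{d-1}$, where $\nu\cdot\zeta=\sum_{i=1}^d\nu_i\zeta_i$; (ii) for some $j$ with $1\le j\le k$, $f_j(\zeta)=0$ for $\sigma$-a.e.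 $\zeta\in\mathbb S^{d-1}$. -/

import Mathlib

open MeasureTheory Metric

noncomputable section

/-- The Euclidean unit sphere of `ℝ^d`. -/
abbrev UnitSphere (d : ℕ) : Type :=
  sphere (0 : EuclideanSpace ℝ (Fin d)) 1

/-- The surface measure on the unit sphere of `ℝ^d` (not normalized). -/
def surfaceMeasure (d : ℕ) : Measure (UnitSphere d) :=
  (volume : Measure (EuclideanSpace ℝ (Fin d))).toSphere

instance (d : ℕ) : IsFiniteMeasure (surfaceMeasure d) :=
  inferInstanceAs (IsFiniteMeasure (volume : Measure (EuclideanSpace ℝ (Fin d))).toSphere)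

/-- The bilinear (not sesquilinear) product `ν · ζ = ∑ ν_i ζ_i` of `ν ∈ ℂ^d` and `ζ ∈ ℝ^d`. -/
def complexDot {d : ℕ} (ν : Fin d → ℂ) (ζ : EuclideanSpace ℝ (Fin d)) : ℂ :=
  ∑ i, ν i * ((ζ i : ℝ) : ℂ)

end

/-! Assume that no `f j` vanishes almost everywhere. Freezing all variables but two at a generic
point where no factor vanishes, and using the symmetry of the sum, shows that each `f j` is a
nonzero multiple of f = `f 0`. Hence f(x)f(y) = H(x+y) and, if k ≥ 3, also f(x)f(y)f(z) = H'(x+y+z)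
almost everywhere (`exists_proportional_of_prod_eq`). It remains to show f = c e^l.

Both cases end alike: they produce a measurable P near 0 in ℝ^d with P(s+v) = P(s)χ(v) and
P(s+z-z')f(z') = P(s)f(z). Mollification turns the first relation into a differentiable one, so P is
an exponential near 0; by the second, f e^{-l} is almost everywhere locally constant, hence constant
because the sphere is connected (`exists_ae_eq_exp_of_translation`).

For d ≥ 3 two factors suffice. Null sets are handled by stating relations for every configuration of
points and almost every g in O(d). Continuity in measure of x ↦ f(gx) makes such relations closed,
which gives f(gx)f(gy) = f(gx')f(gy') whenever x+y = x'+y' (`ae_rotate_mul_eq_of_add_eq`).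
Propagating nonvanishing along rectangles shows that f is nonzero almost everywhere
(`ae_ne_zero_of_rectangle`). Then f(gx)/f(gx') depends only on the chord x-x', and rectangles
inscribed in the sphere make it multiplicative for short chords (`chord_add`).

For d = 2 a nonzero sum of two unit vectors determines the pair up to order, so two factors carry
too little information; this is why (2,2) is excluded. With P(s) = f(x)f(y) for one decomposition s
= x+y, the triple equation reads P(s)f(z) = H'(s+z), and comparing z with z' gives the translation
relation (`exists_ae_eq_exp_of_triple`). -/

open Filter Set
open scoped Topology ENNReal Pointwise

/-! ### Almost everywhere local constancy, and isometries of the sphere -/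

/-- On a preconnected space, a function which is locally constant almost everywhere at a uniform
scale is constant almost everywhere. -/
theorem ae_eq_const_of_ae_dist_lt {X α : Type*} [PseudoMetricSpace X] [SecondCountableTopology X]
    [PreconnectedSpace X] [Nonempty X] [MeasurableSpace X] [OpensMeasurableSpace X]
    (μ : Measure X) [μ.IsOpenPosMeasure] (u : X → α) {δ : ℝ} (hδ : 0 < δ)
    (h : ∀ᵐ z' ∂μ, ∀ᵐ z ∂μ, dist z z' < δ → u z = u z') :
    ∃ c, ∀ᵐ z ∂μ, u z = c := by
  have key : ∀ x : X, ∃ c, ∀ᵐ z ∂μ, z ∈ ball x (δ / 2) → u z = c := by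
    intro x
    have hpos : μ (ball x (δ / 2)) ≠ 0 := (measure_ball_pos μ x (by positivity)).ne'
    obtain ⟨z', hz', hz'2⟩ := ((frequently_ae_mem_iff.2 hpos).and_eventually h).exists
    refine ⟨u z', hz'2.mono fun z hz hzb => hz ?_⟩
    calc dist z z' ≤ dist z x + dist z' x := dist_triangle_right _ _ _
      _ < δ := by
        have := mem_ball.1 hz'; have := mem_ball.1 hzb; linarith
  choose c hc using key
  -- Overlapping balls meet in an open set of positive measure, so their constants agree.
  have hloc : IsLocallyConstant c := by
    refine IsLocallyConstant.iff_exists_open _ |>.2 fun x => ⟨ball x (δ / 2), isOpen_ball,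
      mem_ball_self (by positivity), fun y hy => ?_⟩
    have hpos : μ (ball x (δ / 2) ∩ ball y (δ / 2)) ≠ 0 :=
      ((isOpen_ball.inter isOpen_ball).measure_pos μ
        ⟨y, hy, mem_ball_self (by positivity)⟩).ne'
    obtain ⟨z, hz, hz1, hz2⟩ :=
      ((frequently_ae_mem_iff.2 hpos).and_eventually ((hc x).and (hc y))).exists
    rw [← hz1 hz.1, ← hz2 hz.2]
  let x₀ : X := Classical.arbitrary X
  refine ⟨c x₀, ?_⟩
  refine measure_null_of_locally_null _ fun x _ => ?_
  refine ⟨{z | ¬ u z = c x₀} ∩ ball x (δ / 2),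
    inter_mem_nhdsWithin _ (ball_mem_nhds x (by positivity)), ?_⟩
  have h1 := hc x
  rw [hloc.apply_eq_of_isPreconnected isPreconnected_univ (mem_univ x) (mem_univ x₀)] at h1
  refine measure_mono_null ?_ h1
  rintro z ⟨hz1, hz2⟩ hz3
  exact hz1 (hz3 hz2)

/-- The action of a linear isometry on the unit sphere. -/
noncomputable def sphereMap {d : ℕ} (A : EuclideanSpace ℝ (Fin d) ≃ₗᵢ[ℝ] EuclideanSpace ℝ (Fin d)) :
    UnitSphere d → UnitSphere d :=
  fun x => ⟨A x, by simp⟩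

@[simp] theorem coe_sphereMap {d : ℕ}
    (A : EuclideanSpace ℝ (Fin d) ≃ₗᵢ[ℝ] EuclideanSpace ℝ (Fin d)) (x : UnitSphere d) :
    (sphereMap A x : EuclideanSpace ℝ (Fin d)) = A x := rfl

theorem continuous_sphereMap {d : ℕ}
    (A : EuclideanSpace ℝ (Fin d) ≃ₗᵢ[ℝ] EuclideanSpace ℝ (Fin d)) :
    Continuous (sphereMap A) :=
  (A.continuous.comp continuous_subtype_val).subtype_mk _

/-- `toSphere` measures a set by the volume of the cone over it, and a linear isometry carries cones
to cones. -/
theorem measurePreserving_sphereMap {d : ℕ}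
    (A : EuclideanSpace ℝ (Fin d) ≃ₗᵢ[ℝ] EuclideanSpace ℝ (Fin d)) :
    MeasurePreserving (sphereMap A) (surfaceMeasure d) (surfaceMeasure d) := by
  refine ⟨(continuous_sphereMap A).measurable, ?_⟩
  ext s hs
  have hs' := (continuous_sphereMap A).measurable hs
  rw [Measure.map_apply (continuous_sphereMap A).measurable hs, surfaceMeasure,
    Measure.toSphere_apply' _ hs, Measure.toSphere_apply' _ hs']
  congr 1
  have : Ioo (0 : ℝ) 1 • ((↑) '' (sphereMap A ⁻¹' s) : Set (EuclideanSpace ℝ (Fin d)))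
      = A ⁻¹' (Ioo (0 : ℝ) 1 • ((↑) '' s : Set (EuclideanSpace ℝ (Fin d)))) := by
    ext x
    simp only [Set.mem_smul, mem_preimage]
    constructor
    · rintro ⟨r, hr, _, ⟨y, hy, rfl⟩, rfl⟩
      exact ⟨r, hr, _, ⟨sphereMap A y, hy, rfl⟩, by simp⟩
    · rintro ⟨r, hr, _, ⟨y, hy, rfl⟩, h⟩
      refine ⟨r, hr, _, ⟨sphereMap A.symm y, ?_, rfl⟩, ?_⟩
      · have : sphereMap A (sphereMap A.symm y) = y := Subtype.ext (by simp)
        rwa [mem_preimage, this]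
      · apply A.injective
        simp [← h]
  rw [this]
  exact (A.measurePreserving.measure_preimage_equiv (f := A.toHomeomorph.toMeasurableEquiv) _)

instance instIsOpenPosMeasureSurfaceMeasure (d : ℕ) : (surfaceMeasure d).IsOpenPosMeasure :=
  inferInstanceAs (volume : Measure (EuclideanSpace ℝ (Fin d))).toSphere.IsOpenPosMeasure

theorem preconnectedSpace_unitSphere {d : ℕ} (hd : 2 ≤ d) : PreconnectedSpace (UnitSphere d) := by
  refine Subtype.preconnectedSpace (isPreconnected_sphere ?_ _ _)
  rw [← Module.finrank_eq_rank, finrank_euclideanSpace_fin]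
  exact_mod_cast hd

theorem nonempty_unitSphere {d : ℕ} (hd : 2 ≤ d) : Nonempty (UnitSphere d) :=
  ⟨⟨EuclideanSpace.single ⟨0, by omega⟩ 1, by simp⟩⟩

/-! ### The local multiplicative Pexider equation -/

/-- A `C¹` solution of a local multiplicative Pexider equation is an exponential. -/
theorem exists_eq_mul_exp_of_local_cauchy {V : Type*} [NormedAddCommGroup V]
    [InnerProductSpace ℝ V] {q : V → ℂ} (hq : ContDiff ℝ 1 q) {s₀ : V}
    (hs₀ : q s₀ ≠ 0) {r : ℝ}
    (h : ∀ v ∈ ball (0 : V) r, ∀ᶠ s in 𝓝 s₀, q (s + v) * q s₀ = q s * q (s₀ + v)) :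
    ∃ l : V →L[ℝ] ℂ, ∀ v ∈ ball (0 : V) r, q (s₀ + v) = q s₀ * Complex.exp (l v) := by
  have hd : Differentiable ℝ q := hq.differentiable one_ne_zero
  set l : V →L[ℝ] ℂ := (q s₀)⁻¹ • fderiv ℝ q s₀ with hl
  refine ⟨l, fun v hv => ?_⟩
  -- Differentiating the hypothesis in `s` at `s₀` gives Dq(s₀+v) = q(s₀+v) l, so q(s₀+v) e^{-l v}
  -- is constant.
  have hder : ∀ v ∈ ball (0 : V) r, fderiv ℝ q (s₀ + v) = q (s₀ + v) • l := by
    intro v hv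
    have h1 : HasFDerivAt (fun s => q (s + v) * q s₀) (q s₀ • fderiv ℝ q (s₀ + v)) s₀ := by
      have := ((hd (s₀ + v)).hasFDerivAt.comp s₀ ((hasFDerivAt_id s₀).add_const v))
      exact this.mul_const (q s₀)
    have h2 : HasFDerivAt (fun s => q s * q (s₀ + v)) (q (s₀ + v) • fderiv ℝ q s₀) s₀ :=
      (hd s₀).hasFDerivAt.mul_const _
    have h3 := (h1.congr_of_eventuallyEq ((h v hv).mono fun s hs => hs.symm)).unique h2
    rw [hl, smul_comm, ← h3, smul_smul, inv_mul_cancel₀ hs₀, one_smul]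
  let g : V → ℂ := fun v => q (s₀ + v) * Complex.exp (-l v)
  have hg : ∀ v ∈ ball (0 : V) r, HasFDerivAt g (0 : V →L[ℝ] ℂ) v := by
    intro v hv
    have h1 : HasFDerivAt (fun v => q (s₀ + v)) (fderiv ℝ q (s₀ + v)) v := by
      have := ((hd (s₀ + v)).hasFDerivAt.comp v ((hasFDerivAt_id v).const_add s₀))
      exact this
    have h2 : HasFDerivAt (fun v => Complex.exp (-l v)) (Complex.exp (-l v) • -l) v :=
      (l.hasFDerivAt.neg).cexp
    refine (h1.mul h2).congr_fderiv ?_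
    rw [hder v hv]
    ext w
    simp
    ring
  have hr0 : (0 : V) ∈ ball (0 : V) r := by
    rw [mem_ball_zero_iff] at *
    simpa using (norm_nonneg v).trans_lt hv
  have h0 : g v = g 0 := isOpen_ball.is_const_of_fderiv_eq_zero (𝕜 := ℝ)
    (convex_ball (0 : V) r).isPreconnected
    (fun v hv => (hg v hv).differentiableAt.differentiableWithinAt)
    (fun v hv => (hg v hv).fderiv) hv hr0
  simp only [g, map_zero, neg_zero, Complex.exp_zero, mul_one, add_zero] at h0
  rw [← h0, mul_assoc, ← Complex.exp_add]
  simp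

section LocalCauchy

variable {V : Type*} [NormedAddCommGroup V] [InnerProductSpace ℝ V] [FiniteDimensional ℝ V]
  [MeasurableSpace V] [BorelSpace V]

/-- A measurable solution of a local multiplicative Pexider equation is essentially bounded. -/
theorem ae_norm_le_of_local_pexider {P χ : V → ℂ} (hP : Measurable P) (hχ : Measurable χ) {r : ℝ}
    (hr : 0 < r)
    (h : ∀ᵐ s : V, ∀ᵐ v : V, s ∈ ball (0 : V) r → v ∈ ball (0 : V) r → P (s + v) = P s * χ v)
    (hχ0 : ∀ᵐ v : V, v ∈ ball (0 : V) r → χ v ≠ 0) :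
    ∃ C, ∀ᵐ s : V, s ∈ ball (0 : V) r → ‖P s‖ ≤ C := by
  set m : ℝ≥0∞ := volume (ball (0 : V) r) with hm
  have hm0 : 0 < m := measure_ball_pos _ _ hr
  have hmt : m ≠ ∞ := measure_ball_lt_top.ne
  -- χ is small on `A n` and P is large on `B n`; both shrink to null sets. Once each has less than
  -- half the measure of the ball, some `v` avoids `A n` and the translate of `B n`, and |P s| =
  -- |P(s+v)|/|χ v| ≤ n(n+1).
  let A : ℕ → Set V := fun n => {v | v ∈ ball (0 : V) r ∧ ‖χ v‖ * (n + 1) ≤ 1}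
  let B : ℕ → Set V := fun n => {u | u ∈ ball (0 : V) (2 * r) ∧ (n : ℝ) ≤ ‖P u‖}
  have hA : Tendsto (fun n => volume (A n)) atTop (𝓝 0) := by
    have h1 : volume (⋂ n, A n) = 0 := by
      refine measure_mono_null ?_ hχ0
      intro v hv hv'
      simp only [mem_iInter] at hv
      have h2 : χ v ≠ 0 := hv' (hv 0).1
      obtain ⟨n, hn⟩ := exists_nat_gt (1 / ‖χ v‖)
      have h3 : 0 < ‖χ v‖ := norm_pos_iff.2 h2
      have h4 := (hv n).2
      rw [div_lt_iff₀ h3] at hn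
      nlinarith
    rw [← h1]
    refine tendsto_measure_iInter_atTop (fun n => ?_) (fun n k hnk v hv => ⟨hv.1, ?_⟩) ⟨0, ?_⟩
    · exact (measurableSet_ball.inter
        (measurableSet_le (hχ.norm.mul_const _) measurable_const)).nullMeasurableSet
    · have : (n : ℝ) ≤ k := by exact_mod_cast hnk
      nlinarith [hv.2, norm_nonneg (χ v)]
    · exact ((measure_mono fun v hv => hv.1).trans_lt measure_ball_lt_top).ne
  have hB : Tendsto (fun n => volume (B n)) atTop (𝓝 0) := by
    have h1 : volume (⋂ n, B n) = 0 := by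
      rw [show ⋂ n, B n = ∅ from ?_, measure_empty]
      refine eq_empty_of_forall_notMem fun v hv => ?_
      simp only [mem_iInter] at hv
      obtain ⟨n, hn⟩ := exists_nat_gt ‖P v‖
      exact absurd (hv n).2 (not_le.2 hn)
    rw [← h1]
    refine tendsto_measure_iInter_atTop (fun n => ?_) (fun n k hnk v hv => ⟨hv.1, ?_⟩) ⟨0, ?_⟩
    · exact (measurableSet_ball.inter
        (measurableSet_le measurable_const hP.norm)).nullMeasurableSet
    · have : (n : ℝ) ≤ k := by exact_mod_cast hnk
      exact this.trans hv.2
    · exact ((measure_mono fun v hv => hv.1).trans_lt measure_ball_lt_top).ne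
  have hm2 : 0 < m / 2 := ENNReal.half_pos hm0.ne'
  obtain ⟨n, hnA, hnB⟩ := ((hA.eventually_lt_const hm2).and (hB.eventually_lt_const hm2)).exists
  refine ⟨n * (n + 1), ?_⟩
  filter_upwards [h] with s hs hsr
  have hpos : volume (ball (0 : V) r \ (A n ∪ (fun v => s + v) ⁻¹' B n)) ≠ 0 := by
    intro h0
    have h1 : m ≤ volume (A n ∪ (fun v => s + v) ⁻¹' B n) := by
      have h2 : ball (0 : V) r ⊆ (ball (0 : V) r \ (A n ∪ (fun v => s + v) ⁻¹' B n)) ∪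
          (A n ∪ (fun v => s + v) ⁻¹' B n) := by
        rw [Set.sdiff_union_self]
        exact subset_union_left
      calc m ≤ _ := measure_mono h2
        _ ≤ _ := measure_union_le _ _
        _ = _ := by rw [h0, zero_add]
    have h2 : volume (A n ∪ (fun v => s + v) ⁻¹' B n) < m := by
      refine (measure_union_le _ _).trans_lt ?_
      rw [measure_preimage_add]
      calc _ < m / 2 + m / 2 := ENNReal.add_lt_add hnA hnB
        _ = m := ENNReal.add_halves m
    exact absurd h1 (not_le.2 h2)
  obtain ⟨v, ⟨hvr, hvn⟩, hv⟩ := ((frequently_ae_mem_iff.2 hpos).and_eventually hs).exists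
  have hsv : s + v ∈ ball (0 : V) (2 * r) := by
    rw [mem_ball_zero_iff] at *
    linarith [norm_add_le s v]
  have h3 : 1 < ‖χ v‖ * (n + 1) := by
    by_contra! hc
    exact hvn (Or.inl ⟨hvr, hc⟩)
  have h4 : ‖P (s + v)‖ < n := by
    by_contra! hc
    exact hvn (Or.inr ⟨hsv, hc⟩)
  rw [hv hsr hvr, norm_mul] at h4
  have h5 : ‖P s‖ ≤ ‖P s‖ * (‖χ v‖ * (n + 1)) := le_mul_of_one_le_right (norm_nonneg _) h3.le
  nlinarith

/-- A measurable solution of a local multiplicative Pexider equation agrees almost everywhere with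
an exponential. -/
theorem exists_ae_eq_exp_of_local_pexider {P χ : V → ℂ} (hP : Measurable P) (hχ : Measurable χ)
    {r : ℝ} (hr : 0 < r)
    (h : ∀ᵐ p : V × V, p.1 ∈ ball (0 : V) r → p.2 ∈ ball (0 : V) r →
      P (p.1 + p.2) = P p.1 * χ p.2)
    (hP0 : ∀ᵐ s : V, s ∈ ball (0 : V) r → P s ≠ 0)
    (hχ0 : ∀ᵐ v : V, v ∈ ball (0 : V) r → χ v ≠ 0) :
    ∃ (l : V →L[ℝ] ℂ) (c : ℂ) (ρ : ℝ), c ≠ 0 ∧ 0 < ρ ∧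
      ∀ᵐ s : V, s ∈ ball (0 : V) ρ → P s = c * Complex.exp (l s) := by
  have h12 : ∀ᵐ s : V, ∀ᵐ v : V,
      s ∈ ball (0 : V) r → v ∈ ball (0 : V) r → P (s + v) = P s * χ v :=
    Measure.ae_ae_of_ae_prod h
  have h21 : ∀ᵐ v : V, ∀ᵐ s : V,
      s ∈ ball (0 : V) r → v ∈ ball (0 : V) r → P (s + v) = P s * χ v :=
    Measure.ae_ae_of_ae_prod (Measure.measurePreserving_swap.quasiMeasurePreserving.ae h)
  obtain ⟨C, hC⟩ := ae_norm_le_of_local_pexider hP hχ hr h12 hχ0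
  let Q : V → ℂ := (ball (0 : V) r).indicator P
  have hQ : Integrable Q := by
    rw [integrable_indicator_iff measurableSet_ball]
    refine Measure.integrableOn_of_bounded (M := C) measure_ball_lt_top.ne
      hP.aestronglyMeasurable ?_
    exact (ae_restrict_iff' measurableSet_ball).2 hC
  let φ : ℕ → ContDiffBump (0 : V) := fun n =>
    ⟨(1 / (n + 1 : ℝ)) / 2, 1 / (n + 1 : ℝ), by positivity, half_lt_self (by positivity)⟩
  have hφ : Tendsto (fun n => (φ n).rOut) atTop (𝓝 0) :=
    tendsto_one_div_add_atTop_nhds_zero_nat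
  have hφ' : ∀ᶠ n in atTop, (φ n).rOut ≤ 2 * (φ n).rIn :=
    Eventually.of_forall fun n => by simp only [φ]; linarith
  have hconv := ContDiffBump.ae_convolution_tendsto_right_of_locallyIntegrable
    (μ := (volume : Measure V)) hφ hφ' hQ.locallyIntegrable
  have hpos : (volume : Measure V) (ball (0 : V) (r / 8)) ≠ 0 :=
    (measure_ball_pos _ _ (by positivity)).ne'
  obtain ⟨s₀, hs₀, hs₀c, hs₀P⟩ :=
    ((frequently_ae_mem_iff.2 hpos).and_eventually (hconv.and hP0)).exists
  have hs₀r : s₀ ∈ ball (0 : V) r := ball_subset_ball (by linarith) hs₀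
  have hQs₀ : Q s₀ ≠ 0 := by
    simp only [Q, indicator_of_mem hs₀r]
    exact hs₀P hs₀r
  -- By Lebesgue differentiation a fine enough mollification is still nonzero at `s₀`.
  obtain ⟨n, hn1, hn2⟩ := ((hs₀c.eventually_ne hQs₀).and
    (hφ.eventually_lt_const (show (0 : ℝ) < r / 4 by positivity))).exists
  set q : V → ℂ := convolution ((φ n).normed volume) Q (ContinuousLinearMap.lsmul ℝ ℝ) volume
    with hq
  have hqd : ContDiff ℝ 1 q :=
    (φ n).hasCompactSupport_normed.contDiff_convolution_left _ (φ n).contDiff_normed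
      hQ.locallyIntegrable
  -- Mollifying in `s` keeps the equation with the same χ; the radii r/4 and r/2 keep all arguments
  -- in the ball where `Q` is `P`.
  have hmul : ∀ᵐ v : V, v ∈ ball (0 : V) (r / 2) → ∀ s ∈ ball (0 : V) (r / 4),
      q (s + v) = q s * χ v := by
    filter_upwards [h21] with v hv hvr s hs
    simp only [hq, convolution, ContinuousLinearMap.lsmul_apply]
    rw [← integral_mul_const]
    refine integral_congr_ae ?_
    have := (quasiMeasurePreserving_sub_left (volume : Measure V) s).ae hv
    filter_upwards [this] with t ht
    by_cases hts : t ∈ ball (0 : V) (r / 4)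
    · rw [mem_ball_zero_iff] at *
      have h1 : ‖s - t‖ < r / 2 := by linarith [norm_sub_le s t]
      have h2 : ‖s + v - t‖ < r := by
        rw [show s + v - t = (s - t) + v by abel]
        linarith [norm_add_le (s - t) v]
      have h3 : ‖s - t‖ < r := by linarith
      simp only [Q]
      rw [indicator_of_mem (mem_ball_zero_iff.2 h2), indicator_of_mem (mem_ball_zero_iff.2 h3),
        show s + v - t = (s - t) + v by abel, ht h3 (mem_ball_zero_iff.2 (by linarith)), smul_mul_assoc]
    · have : (φ n).normed volume t = 0 := by
        have : t ∉ Function.support ((φ n).normed volume) := by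
          rw [ContDiffBump.support_normed_eq]
          exact fun hc => hts (ball_subset_ball hn2.le hc)
        simpa using this
      simp [this]
  have hqc : Continuous q := hqd.continuous
  -- Eliminating χ by comparison with `s₀` leaves an equation between continuous functions, so it
  -- holds everywhere.
  have hcauchy : ∀ v ∈ ball (0 : V) (r / 2), ∀ s ∈ ball (0 : V) (r / 4),
      q (s + v) * q s₀ = q s * q (s₀ + v) := by
    intro v hv s hs
    refine Measure.eqOn_open_of_ae_eq (μ := (volume : Measure V)) (U := ball (0 : V) (r / 2))
      (f := fun v => q (s + v) * q s₀) (g := fun v => q s * q (s₀ + v)) ?_ isOpen_ball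
      (by fun_prop) (by fun_prop) hv
    refine (ae_restrict_iff' measurableSet_ball).2 ?_
    filter_upwards [hmul] with v hv hvr
    rw [hv hvr s hs, hv hvr s₀ (ball_subset_ball (by linarith) hs₀)]
    ring
  have hs₀4 : s₀ ∈ ball (0 : V) (r / 4) := ball_subset_ball (by linarith) hs₀
  obtain ⟨l, hl⟩ := exists_eq_mul_exp_of_local_cauchy hqd hn1 fun v hv => by
    filter_upwards [isOpen_ball.mem_nhds hs₀4] with s hs using hcauchy v hv s hs
  have hχl : ∀ᵐ v : V, v ∈ ball (0 : V) (r / 2) → χ v = Complex.exp (l v) := by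
    filter_upwards [hmul] with v hv hvr
    have h1 := hl v hvr
    rw [hv hvr s₀ hs₀4] at h1
    exact mul_left_cancel₀ hn1 h1
  -- χ is now an exponential; the equation at one good base point `s₁` transfers this to `P`.
  obtain ⟨s₁, hs₁, hs₁P, hs₁v⟩ :=
    ((frequently_ae_mem_iff.2 hpos).and_eventually (hP0.and h12)).exists
  have hs₁r : s₁ ∈ ball (0 : V) r := ball_subset_ball (by linarith) hs₁
  refine ⟨l, P s₁ * Complex.exp (-l s₁), r / 4, mul_ne_zero (hs₁P hs₁r) (Complex.exp_ne_zero _),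
    by positivity, ?_⟩
  have h5 := hs₁v.and hχl
  have h6 := (measurePreserving_sub_right (volume : Measure V) s₁).quasiMeasurePreserving.ae h5
  filter_upwards [h6] with u hu hur
  have h7 : u - s₁ ∈ ball (0 : V) (r / 2) := by
    rw [mem_ball_zero_iff] at *
    linarith [norm_sub_le u s₁]
  have h8 := hu.1 hs₁r (ball_subset_ball (by linarith) h7)
  rw [hu.2 h7, add_sub_cancel, map_sub] at h8
  rw [h8, mul_assoc, ← Complex.exp_add]
  congr 2
  ring

end LocalCauchy

/-! ### From translations to exponentials on the sphere -/

/-- If translating `P` by the difference `z - z'` of two points of the sphere amounts to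
multiplication by `F z / F z'`, and `P` solves a local Pexider equation, then `F` is an exponential
on the sphere. -/
theorem exists_ae_eq_exp_of_translation {d : ℕ} (hd : 2 ≤ d)
    {F : UnitSphere d → ℂ}
    {P χ : EuclideanSpace ℝ (Fin d) → ℂ} (hP : Measurable P) (hχ : Measurable χ)
    {r : ℝ} (hr : 0 < r)
    (h : ∀ᵐ p : EuclideanSpace ℝ (Fin d) × EuclideanSpace ℝ (Fin d),
      p.1 ∈ ball (0 : EuclideanSpace ℝ (Fin d)) r → p.2 ∈ ball (0 : EuclideanSpace ℝ (Fin d)) r →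
      P (p.1 + p.2) = P p.1 * χ p.2)
    (hP0 : ∀ᵐ s : EuclideanSpace ℝ (Fin d), s ∈ ball (0 : EuclideanSpace ℝ (Fin d)) r → P s ≠ 0)
    (hχ0 : ∀ᵐ v : EuclideanSpace ℝ (Fin d), v ∈ ball (0 : EuclideanSpace ℝ (Fin d)) r → χ v ≠ 0)
    (hF0 : ∀ᵐ z : UnitSphere d ∂surfaceMeasure d, F z ≠ 0)
    (htr : ∀ᵐ z' : UnitSphere d ∂surfaceMeasure d, ∀ᵐ z : UnitSphere d ∂surfaceMeasure d, dist z z' < r →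
      ∀ᵐ s : EuclideanSpace ℝ (Fin d), s ∈ ball (0 : EuclideanSpace ℝ (Fin d)) r →
        P (s + ((z : EuclideanSpace ℝ (Fin d)) - z')) * F z' = P s * F z) :
    ∃ (l : EuclideanSpace ℝ (Fin d) →L[ℝ] ℂ) (c : ℂ), c ≠ 0 ∧
      ∀ᵐ z : UnitSphere d ∂surfaceMeasure d, F z = c * Complex.exp (l z) := by
  obtain ⟨l, c₀, ρ, hc₀, hρ, hexp⟩ := exists_ae_eq_exp_of_local_pexider hP hχ hr h hP0 hχ0
  have := preconnectedSpace_unitSphere hd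
  have := nonempty_unitSphere hd
  -- With `ρ / 2`, both s and s + (z - z') stay where `P` is an exponential.
  set δ : ℝ := min r (ρ / 2) with hδ
  have hδ0 : 0 < δ := lt_min hr (by positivity)
  have hδr : δ ≤ r := min_le_left _ _
  have hδρ : δ ≤ ρ / 2 := min_le_right _ _
  obtain ⟨c, hc⟩ := ae_eq_const_of_ae_dist_lt (surfaceMeasure d)
    (fun z => F z * Complex.exp (-l z)) hδ0 (by
      filter_upwards [htr] with z' hz'
      filter_upwards [hz'] with z hz hzz
      have h1 := hz (hzz.trans_le hδr)
      have h2 := (measurePreserving_add_right (volume : Measure (EuclideanSpace ℝ (Fin d)))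
        ((z : EuclideanSpace ℝ (Fin d)) - z')).quasiMeasurePreserving.ae hexp
      have hpos : (volume : Measure (EuclideanSpace ℝ (Fin d)))
          (ball (0 : EuclideanSpace ℝ (Fin d)) δ) ≠ 0 := (measure_ball_pos _ _ hδ0).ne'
      obtain ⟨s, hs, hs1, hs2, hs3⟩ :=
        ((frequently_ae_mem_iff.2 hpos).and_eventually (h1.and (h2.and hexp))).exists
      have hzz' : ‖(z : EuclideanSpace ℝ (Fin d)) - z'‖ < δ := by
        rwa [← dist_eq_norm]
      rw [mem_ball_zero_iff] at hs
      have e1 := hs1 (mem_ball_zero_iff.2 (by linarith))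
      rw [hs2 (mem_ball_zero_iff.2 (by linarith [norm_add_le s ((z : EuclideanSpace ℝ (Fin d)) - z')])),
        hs3 (mem_ball_zero_iff.2 (by linarith)), map_add, Complex.exp_add, map_sub,
        Complex.exp_sub] at e1
      have n1 := Complex.exp_ne_zero (l s)
      have n2 := Complex.exp_ne_zero (l z)
      have n3 := Complex.exp_ne_zero (l z')
      rw [Complex.exp_neg, Complex.exp_neg]
      field_simp at e1 ⊢
      linear_combination -e1)
  refine ⟨l, c, ?_, ?_⟩
  · rintro rfl
    obtain ⟨z, hz1, hz2⟩ := (hc.and hF0).exists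
    exact mul_ne_zero hz2 (Complex.exp_ne_zero _) hz1
  · filter_upwards [hc] with z hz
    rw [← hz, mul_assoc, ← Complex.exp_add]
    simp

/-! ### Reduction to a single function -/

section Update

variable {X : Type*} [MeasurableSpace X] (μ : Measure X) [SigmaFinite μ]

/-- Resampling one coordinate of a product space preserves null sets. -/
theorem quasiMeasurePreserving_update {n : ℕ} (i : Fin (n + 1)) :
    Measure.QuasiMeasurePreserving
      (fun p : (Fin (n + 1) → X) × X => Function.update p.1 i p.2)
      ((Measure.pi fun _ : Fin (n + 1) => μ).prod μ) (Measure.pi fun _ : Fin (n + 1) => μ) := by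
  have he := measurePreserving_piFinSuccAbove (fun _ : Fin (n + 1) => μ) i
  set e := MeasurableEquiv.piFinSuccAbove (fun _ : Fin (n + 1) => X) i with hedef
  have h1 : Measure.QuasiMeasurePreserving (fun ζ => (e ζ).2) (Measure.pi fun _ : Fin (n + 1) => μ)
      (Measure.pi fun _ : Fin n => μ) :=
    Measure.quasiMeasurePreserving_snd.comp he.quasiMeasurePreserving
  have h2 : Measure.QuasiMeasurePreserving
      (fun p : (Fin (n + 1) → X) × X => (p.2, (e p.1).2))
      ((Measure.pi fun _ : Fin (n + 1) => μ).prod μ) (μ.prod (Measure.pi fun _ : Fin n => μ)) := by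
    have h3 := QuasiMeasurePreserving.prodMap h1 (Measure.QuasiMeasurePreserving.id μ)
    exact (Measure.measurePreserving_swap (μ := Measure.pi fun _ : Fin n => μ)
      (ν := μ)).quasiMeasurePreserving.comp h3
  have h4 := he.symm.quasiMeasurePreserving.comp h2
  convert h4 using 1
  funext p
  simp only [Function.comp]
  rw [MeasurableEquiv.eq_symm_apply]
  ext j
  · simp [hedef, MeasurableEquiv.piFinSuccAbove, Fin.insertNthEquiv]
  · simp [hedef, MeasurableEquiv.piFinSuccAbove, Fin.insertNthEquiv, Fin.removeNth]

/-- Almost every ζ can thus serve as a frozen background while two coordinates are resampled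
independently. -/
theorem ae_pi_update₂ {n : ℕ} {p : (Fin (n + 1) → X) → Prop}
    (h : ∀ᵐ ζ ∂(Measure.pi fun _ : Fin (n + 1) => μ), p ζ) (i j : Fin (n + 1)) :
    ∀ᵐ ζ ∂(Measure.pi fun _ : Fin (n + 1) => μ), ∀ᵐ q ∂(μ.prod μ),
      p (Function.update (Function.update ζ i q.1) j q.2) := by
  have h1 := QuasiMeasurePreserving.prodMap (quasiMeasurePreserving_update μ i) (Measure.QuasiMeasurePreserving.id μ)
  have h2 := (quasiMeasurePreserving_update μ j).comp h1
  have h3 := h2.comp (measurePreserving_prodAssoc (Measure.pi fun _ : Fin (n + 1) => μ) μ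
    μ).symm.quasiMeasurePreserving
  exact Measure.ae_ae_of_ae_prod (h3.ae h)

theorem ae_pi_update₃ {n : ℕ} {p : (Fin (n + 1) → X) → Prop}
    (h : ∀ᵐ ζ ∂(Measure.pi fun _ : Fin (n + 1) => μ), p ζ) (i j k : Fin (n + 1)) :
    ∀ᵐ ζ ∂(Measure.pi fun _ : Fin (n + 1) => μ), ∀ᵐ q ∂((μ.prod μ).prod μ),
      p (Function.update (Function.update (Function.update ζ i q.1.1) j q.1.2) k q.2) := by
  have h1 := QuasiMeasurePreserving.prodMap (quasiMeasurePreserving_update μ i) (Measure.QuasiMeasurePreserving.id μ)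
  have h2 := (quasiMeasurePreserving_update μ j).comp h1
  have h3 := h2.comp (measurePreserving_prodAssoc (Measure.pi fun _ : Fin (n + 1) => μ) μ
    μ).symm.quasiMeasurePreserving
  have h4 := (quasiMeasurePreserving_update μ k).comp
    (QuasiMeasurePreserving.prodMap h3 (Measure.QuasiMeasurePreserving.id μ))
  have h5 := h4.comp (measurePreserving_prodAssoc (Measure.pi fun _ : Fin (n + 1) => μ) (μ.prod μ)
    μ).symm.quasiMeasurePreserving
  exact Measure.ae_ae_of_ae_prod (h5.ae h)

end Update

/-- A general commutative monoid lets the same formula split sums, read in `Multiplicative W`. -/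
theorem prod_update₂ {k : ℕ} {X M : Type*} [CommMonoid M] (f : Fin k → X → M) (ζ : Fin k → X)
    {i j : Fin k} (hij : i ≠ j) (x y : X) :
    ∏ l, f l (Function.update (Function.update ζ i x) j y l) =
      f i x * f j y * ∏ l ∈ (Finset.univ.erase i).erase j, f l (ζ l) := by
  rw [← Finset.mul_prod_erase Finset.univ _ (Finset.mem_univ i),
    ← Finset.mul_prod_erase (Finset.univ.erase i) _ (Finset.mem_erase.2 ⟨hij.symm,
      Finset.mem_univ j⟩), ← mul_assoc]
  congr 1
  · simp [hij]
  · refine Finset.prod_congr rfl fun l hl => ?_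
    simp only [Finset.mem_erase] at hl
    simp [hl.1, hl.2.1]

theorem prod_update₃ {k : ℕ} {X M : Type*} [CommMonoid M] (f : Fin k → X → M) (ζ : Fin k → X)
    {i j m : Fin k} (hij : i ≠ j) (him : i ≠ m) (hjm : j ≠ m) (x y z : X) :
    ∏ l, f l (Function.update (Function.update (Function.update ζ i x) j y) m z l) =
      f i x * f j y * f m z * ∏ l ∈ ((Finset.univ.erase i).erase j).erase m, f l (ζ l) := by
  rw [← Finset.mul_prod_erase Finset.univ _ (Finset.mem_univ i),
    ← Finset.mul_prod_erase (Finset.univ.erase i) _ (Finset.mem_erase.2 ⟨hij.symm,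
      Finset.mem_univ j⟩),
    ← Finset.mul_prod_erase ((Finset.univ.erase i).erase j) _ (Finset.mem_erase.2 ⟨hjm.symm,
      Finset.mem_erase.2 ⟨him.symm, Finset.mem_univ m⟩⟩), ← mul_assoc, ← mul_assoc]
  congr 1
  · simp [hij, him, hjm]
  · refine Finset.prod_congr rfl fun l hl => ?_
    simp only [Finset.mem_erase] at hl
    simp [hl.1, hl.2.1, hl.2.2.1]

/-- Reduction of a `k`-fold product equation with functions not vanishing identically to an
equation with two, respectively three, factors and a single function. -/
theorem exists_proportional_of_prod_eq {X W : Type*} [MeasurableSpace X] (μ : Measure X)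
    [SigmaFinite μ] [AddCommGroup W] (ι : X → W) {n : ℕ} (hn : 1 ≤ n)
    (f : Fin (n + 1) → X → ℂ) (hf : ∀ j, ¬ ∀ᵐ x ∂μ, f j x = 0) (h : W → ℂ)
    (heq : ∀ᵐ ζ ∂(Measure.pi fun _ : Fin (n + 1) => μ), ∏ j, f j (ζ j) = h (∑ j, ι (ζ j))) :
    (∀ j, ∃ c : ℂ, c ≠ 0 ∧ ∀ᵐ x ∂μ, f j x = c * f 0 x) ∧
    (∃ H : W → ℂ, ∀ᵐ q ∂(μ.prod μ), f 0 q.1 * f 0 q.2 = H (ι q.1 + ι q.2)) ∧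
    (2 ≤ n → ∃ H : W → ℂ, ∀ᵐ q ∂((μ.prod μ).prod μ),
      f 0 q.1.1 * f 0 q.1.2 * f 0 q.2 = H (ι q.1.1 + ι q.1.2 + ι q.2)) := by
  have hbase : ∃ᵐ ζ ∂(Measure.pi fun _ : Fin (n + 1) => μ), ∀ j, f j (ζ j) ≠ 0 := by
    have : (Measure.pi fun _ : Fin (n + 1) => μ) (Set.pi univ fun j => {x | f j x ≠ 0}) ≠ 0 := by
      rw [Measure.pi_pi]
      exact Finset.prod_ne_zero_iff.2 fun j _ => hf j
    refine (frequently_ae_mem_iff.2 this).mono fun ζ hζ j => hζ j (mem_univ j)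
  have pair : ∀ j, (0 : Fin (n + 1)) ≠ j → ∃ H : W → ℂ, ∀ᵐ q ∂(μ.prod μ),
      f 0 q.1 * f j q.2 = H (ι q.1 + ι q.2) := by
    intro j hj
    -- The frozen factors form a nonzero constant `R`, which is absorbed into `H`.
    obtain ⟨ζ, hζ, hζ2⟩ := (hbase.and_eventually (ae_pi_update₂ μ heq 0 j)).exists
    set R : ℂ := ∏ l ∈ (Finset.univ.erase 0).erase j, f l (ζ l) with hR
    have hR0 : R ≠ 0 := Finset.prod_ne_zero_iff.2 fun l _ => hζ l
    refine ⟨fun w => h (w + ∑ l ∈ (Finset.univ.erase 0).erase j, ι (ζ l)) / R, ?_⟩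
    filter_upwards [hζ2] with q hq
    have h2 := prod_update₂ (M := Multiplicative W) (fun _ x => Multiplicative.ofAdd (ι x)) ζ hj q.1 q.2
    rw [← ofAdd_sum, ← ofAdd_sum, ← ofAdd_add, ← ofAdd_add, Multiplicative.ofAdd.injective.eq_iff] at h2
    rw [prod_update₂ f ζ hj, h2] at hq
    rw [← hq, mul_div_cancel_right₀ _ hR0]
  have prop : ∀ j, ∃ c : ℂ, c ≠ 0 ∧ ∀ᵐ x ∂μ, f j x = c * f 0 x := by
    intro j
    by_cases hj : (0 : Fin (n + 1)) = j
    · exact ⟨1, one_ne_zero, by simp [hj]⟩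
    obtain ⟨H, hH⟩ := pair j hj
    have hsw := (Measure.measurePreserving_swap (μ := μ) (ν := μ)).quasiMeasurePreserving.ae hH
    -- The right side is symmetric in the two variables; fixing one with `f 0 y ≠ 0` yields
    -- proportionality.
    have hboth : ∀ᵐ q ∂(μ.prod μ), f 0 q.1 * f j q.2 = f 0 q.2 * f j q.1 := by
      filter_upwards [hH, hsw] with q h1 h2
      simp only [Prod.fst_swap, Prod.snd_swap] at h2
      rw [h1, h2, add_comm]
    have h3 := Measure.ae_ae_of_ae_prod hboth
    obtain ⟨y, hy1, hy2⟩ := ((not_eventually.1 (hf 0)).and_eventually h3).exists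
    have h4 : ∀ᵐ x ∂μ, f j x = f j y / f 0 y * f 0 x := by
      filter_upwards [hy2] with x hx
      field_simp
      linear_combination hx
    refine ⟨f j y / f 0 y, fun h0 => hf j ?_, h4⟩
    filter_upwards [h4] with x hx
    rw [hx, h0, zero_mul]
  refine ⟨prop, ?_, fun hn2 => ?_⟩
  · have h01 : (0 : Fin (n + 1)) ≠ ⟨1, by omega⟩ := by simp [Fin.ext_iff]
    obtain ⟨H, hH⟩ := pair _ h01
    obtain ⟨c, hc, hcf⟩ := prop ⟨1, by omega⟩
    refine ⟨fun w => H w / c, ?_⟩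
    filter_upwards [hH, Measure.quasiMeasurePreserving_snd.ae hcf] with q h1 h2
    rw [← h1, h2]
    field_simp
  · have h01 : (0 : Fin (n + 1)) ≠ ⟨1, by omega⟩ := by simp [Fin.ext_iff]
    have h02 : (0 : Fin (n + 1)) ≠ ⟨2, by omega⟩ := by simp [Fin.ext_iff]
    have h12 : (⟨1, by omega⟩ : Fin (n + 1)) ≠ ⟨2, by omega⟩ := by simp [Fin.ext_iff]
    obtain ⟨ζ, hζ, hζ2⟩ := (hbase.and_eventually
      (ae_pi_update₃ μ heq 0 ⟨1, by omega⟩ ⟨2, by omega⟩)).exists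
    set R : ℂ := ∏ l ∈ ((Finset.univ.erase 0).erase ⟨1, by omega⟩).erase ⟨2, by omega⟩, f l (ζ l)
      with hR
    have hR0 : R ≠ 0 := Finset.prod_ne_zero_iff.2 fun l _ => hζ l
    obtain ⟨c₁, hc₁, hcf₁⟩ := prop ⟨1, by omega⟩
    obtain ⟨c₂, hc₂, hcf₂⟩ := prop ⟨2, by omega⟩
    refine ⟨fun w => h (w + ∑ l ∈ ((Finset.univ.erase 0).erase
      (⟨1, by omega⟩ : Fin (n + 1))).erase ⟨2, by omega⟩, ι (ζ l)) / R / (c₁ * c₂), ?_⟩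
    filter_upwards [hζ2, (Measure.quasiMeasurePreserving_snd.comp
      Measure.quasiMeasurePreserving_fst).ae hcf₁, Measure.quasiMeasurePreserving_snd.ae hcf₂]
      with q hq h1 h2
    have h3 := prod_update₃ (M := Multiplicative W) (fun _ x => Multiplicative.ofAdd (ι x)) ζ
      h01 h02 h12 q.1.1 q.1.2 q.2
    rw [← ofAdd_sum, ← ofAdd_sum, ← ofAdd_add, ← ofAdd_add, ← ofAdd_add,
      Multiplicative.ofAdd.injective.eq_iff] at h3
    rw [prod_update₃ f ζ h01 h02 h12, h3] at hq
    simp only [Function.comp] at h1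
    rw [← hq, mul_div_cancel_right₀ _ hR0, h1, h2]
    field_simp

/-! ### The orthogonal group acting on the sphere -/

/-- The group of linear isometries of `ℝ^d`, with its operator norm topology. -/
noncomputable abbrev RotationGroup (d : ℕ) : Type :=
  unitary (EuclideanSpace ℝ (Fin d) →L[ℝ] EuclideanSpace ℝ (Fin d))

instance instContinuousStarEuclideanEnd (d : ℕ) :
    ContinuousStar (EuclideanSpace ℝ (Fin d) →L[ℝ] EuclideanSpace ℝ (Fin d)) :=
  ⟨ContinuousLinearMap.adjoint.continuous⟩

instance instCompactSpaceRotationGroup (d : ℕ) : CompactSpace (RotationGroup d) := by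
  refine isCompact_iff_compactSpace.1 (Metric.isCompact_of_isClosed_isBounded isClosed_unitary ?_)
  refine (Metric.isBounded_iff_subset_closedBall 0).2 ⟨1, fun u hu => ?_⟩
  rw [mem_closedBall_zero_iff]
  refine ContinuousLinearMap.opNorm_le_bound _ zero_le_one fun x => ?_
  rw [u.norm_map_of_mem_unitary hu, one_mul]

/-- A right invariant Haar measure on the group of linear isometries of `ℝ^d`. -/
noncomputable def rotationMeasure (d : ℕ) : Measure (RotationGroup d) :=
  (Measure.haar : Measure (RotationGroup d)).inv

instance instIsFiniteMeasureRotationMeasure (d : ℕ) : IsFiniteMeasure (rotationMeasure d) := by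
  rw [rotationMeasure, Measure.inv_def]
  infer_instance

instance instIsMulRightInvariantRotationMeasure (d : ℕ) :
    (rotationMeasure d).IsMulRightInvariant := by
  rw [rotationMeasure]
  infer_instance

instance instNeZeroRotationMeasure (d : ℕ) : NeZero (rotationMeasure d) := by
  refine ⟨fun h => ?_⟩
  have h1 : (rotationMeasure d) univ = 0 := by simp [h]
  rw [rotationMeasure, Measure.inv_apply, inv_univ] at h1
  exact isOpen_univ.measure_ne_zero (Measure.haar : Measure (RotationGroup d)) univ_nonempty h1

/-- The action of `RotationGroup d` on the unit sphere. -/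
noncomputable def rotate {d : ℕ} (g : RotationGroup d) (x : UnitSphere d) : UnitSphere d :=
  sphereMap (Unitary.linearIsometryEquiv g) x

@[simp] theorem coe_rotate {d : ℕ} (g : RotationGroup d) (x : UnitSphere d) :
    (rotate g x : EuclideanSpace ℝ (Fin d)) =
      (g : EuclideanSpace ℝ (Fin d) →L[ℝ] EuclideanSpace ℝ (Fin d)) x := rfl

theorem rotate_mul {d : ℕ} (g k : RotationGroup d) (x : UnitSphere d) :
    rotate (g * k) x = rotate g (rotate k x) := rfl

theorem continuous_rotate {d : ℕ} :
    Continuous fun p : RotationGroup d × UnitSphere d => rotate p.1 p.2 := by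
  refine Continuous.subtype_mk (f := fun p : RotationGroup d × UnitSphere d =>
    (p.1 : EuclideanSpace ℝ (Fin d) →L[ℝ] EuclideanSpace ℝ (Fin d)) p.2) ?_ _
  exact (continuous_subtype_val.comp continuous_fst).clm_apply
    (continuous_subtype_val.comp continuous_snd)

theorem continuous_rotate_left {d : ℕ} (x : UnitSphere d) :
    Continuous fun g : RotationGroup d => rotate g x :=
  continuous_rotate.comp (Continuous.prodMk_left x)

theorem measurable_rotate_left {d : ℕ} (x : UnitSphere d) :
    Measurable fun g : RotationGroup d => rotate g x :=
  (continuous_rotate_left x).measurable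

/-- The reflection in the hyperplane orthogonal to `e`. -/
noncomputable def hyperplaneReflection {d : ℕ} (e : EuclideanSpace ℝ (Fin d)) : RotationGroup d :=
  Unitary.linearIsometryEquiv.symm ((ℝ ∙ e)ᗮ.reflection)

theorem hyperplaneReflection_apply {d : ℕ} (e x : EuclideanSpace ℝ (Fin d)) :
    (hyperplaneReflection e : EuclideanSpace ℝ (Fin d) →L[ℝ] EuclideanSpace ℝ (Fin d)) x =
      x - (2 * inner ℝ e x / ‖e‖ ^ 2) • e := by
  change (ℝ ∙ e)ᗮ.reflection x = _
  rw [Submodule.reflection_orthogonal_apply, Submodule.reflection_singleton_apply]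
  simp only [RCLike.ofReal_real_eq_id, id]
  rw [neg_sub, ← smul_assoc]
  congr 2
  rw [nsmul_eq_mul]
  push_cast
  ring

theorem hyperplaneReflection_sub {d : ℕ} {x y : EuclideanSpace ℝ (Fin d)} (h : ‖x‖ = ‖y‖) :
    (hyperplaneReflection (x - y) : EuclideanSpace ℝ (Fin d) →L[ℝ] EuclideanSpace ℝ (Fin d)) x = y := by
  exact Submodule.reflection_sub h

/-- Two pairs of points of the sphere at the same distance are congruent. -/
theorem exists_rotate_eq {d : ℕ} {x y x' y' : UnitSphere d} (h : dist x y = dist x' y') :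
    ∃ k : RotationGroup d, rotate k x = x' ∧ rotate k y = y' := by
  -- One reflection moves x to x'. The next one, taking `y₁` to `y'`, fixes x' because x' is
  -- equidistant from both.
  set k₁ := hyperplaneReflection ((x : EuclideanSpace ℝ (Fin d)) - (x' : EuclideanSpace ℝ (Fin d))) with hk₁
  have h1 : rotate k₁ x = x' := by
    refine Subtype.ext (hyperplaneReflection_sub ?_)
    rw [norm_eq_of_mem_sphere, norm_eq_of_mem_sphere]
  set y₁ := rotate k₁ y with hy₁
  have h2 : dist x' y₁ = dist x' y' := by
    rw [← h, ← h1, hy₁]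
    exact (Unitary.linearIsometryEquiv k₁).dist_map _ _
  set k₂ := hyperplaneReflection ((y₁ : EuclideanSpace ℝ (Fin d)) - (y' : EuclideanSpace ℝ (Fin d))) with hk₂
  have h3 : rotate k₂ y₁ = y' := by
    refine Subtype.ext (hyperplaneReflection_sub ?_)
    rw [norm_eq_of_mem_sphere, norm_eq_of_mem_sphere]
  have h4 : rotate k₂ x' = x' := by
    refine Subtype.ext ?_
    rw [coe_rotate, hk₂, hyperplaneReflection_apply]
    have : inner ℝ ((y₁ : EuclideanSpace ℝ (Fin d)) - y') (x' : EuclideanSpace ℝ (Fin d)) = 0 := by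
      rw [Subtype.dist_eq, Subtype.dist_eq, dist_eq_norm, dist_eq_norm] at h2
      have e1 := norm_sub_sq_real (x' : EuclideanSpace ℝ (Fin d)) y₁
      have e2 := norm_sub_sq_real (x' : EuclideanSpace ℝ (Fin d)) y'
      rw [h2] at e1
      simp only [norm_eq_of_mem_sphere] at e1 e2
      rw [inner_sub_left, real_inner_comm, real_inner_comm (x' : EuclideanSpace ℝ (Fin d)) y']
      linarith
    rw [this]
    simp
  exact ⟨k₂ * k₁, by rw [rotate_mul, h1, h4], by rw [rotate_mul, ← hy₁, h3]⟩

theorem exists_rotate_eq_left {d : ℕ} (x x' : UnitSphere d) :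
    ∃ k : RotationGroup d, rotate k x = x' := by
  obtain ⟨k, hk, -⟩ := exists_rotate_eq (x := x) (y := x) (x' := x') (y' := x') (by simp)
  exact ⟨k, hk⟩

theorem measurePreserving_rotate {d : ℕ} (g : RotationGroup d) :
    MeasurePreserving (rotate g) (surfaceMeasure d) (surfaceMeasure d) :=
  measurePreserving_sphereMap _

/-- The orbit measure of the right Haar measure does not depend on the base point. -/
theorem map_rotate_eq {d : ℕ} (x y : UnitSphere d) :
    (rotationMeasure d).map (fun g => rotate g x) = (rotationMeasure d).map fun g => rotate g y := by
  obtain ⟨k, rfl⟩ := exists_rotate_eq_left x y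
  have h := (measurePreserving_mul_right (rotationMeasure d) k).map_eq
  conv_lhs => rw [← h]
  rw [Measure.map_map (measurable_rotate_left x) (measurable_mul_const k)]
  rfl

/-- This is where right invariance matters: a relation at the points x, y becomes one at k x, k y.
-/
theorem ae_rotate_mul_right {d : ℕ} {p : RotationGroup d → Prop}
    (h : ∀ᵐ g ∂rotationMeasure d, p g) (k : RotationGroup d) :
    ∀ᵐ g ∂rotationMeasure d, p (g * k) :=
  (measurePreserving_mul_right (rotationMeasure d) k).quasiMeasurePreserving.ae h

/-- A property of almost every pair of points of the sphere holds, for almost every pair, for almost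
all rotations of this pair. -/
theorem ae_ae_rotate_prod {d : ℕ} {p : UnitSphere d × UnitSphere d → Prop}
    (h : ∀ᵐ q ∂((surfaceMeasure d).prod (surfaceMeasure d)), p q) :
    ∀ᵐ q ∂((surfaceMeasure d).prod (surfaceMeasure d)), ∀ᵐ g ∂rotationMeasure d,
      p (rotate g q.1, rotate g q.2) := by
  have h1 : Measure.QuasiMeasurePreserving
      (fun r : RotationGroup d × (UnitSphere d × UnitSphere d) =>
        (rotate r.1 r.2.1, rotate r.1 r.2.2))
      ((rotationMeasure d).prod ((surfaceMeasure d).prod (surfaceMeasure d)))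
      ((surfaceMeasure d).prod (surfaceMeasure d)) := by
    refine QuasiMeasurePreserving.prod_of_right ?_ (Eventually.of_forall fun g => ?_)
    · refine (Continuous.prodMk ?_ ?_).measurable
      · exact continuous_rotate.comp (by fun_prop : Continuous
          fun r : RotationGroup d × (UnitSphere d × UnitSphere d) => (r.1, r.2.1))
      · exact continuous_rotate.comp (by fun_prop : Continuous
          fun r : RotationGroup d × (UnitSphere d × UnitSphere d) => (r.1, r.2.2))
    · exact ((measurePreserving_rotate g).prod (measurePreserving_rotate g)).quasiMeasurePreserving
  have h2 := h1.comp (Measure.measurePreserving_swap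
    (μ := (surfaceMeasure d).prod (surfaceMeasure d)) (ν := rotationMeasure d)).quasiMeasurePreserving
  exact Measure.ae_ae_of_ae_prod (h2.ae h)

/-- Fubini provides one good point; transitivity and right invariance then reach every point. -/
theorem ae_rotate_of_ae {d : ℕ} {p : UnitSphere d → Prop} (h : ∀ᵐ x ∂surfaceMeasure d, p x)
    (x : UnitSphere d) : ∀ᵐ g ∂rotationMeasure d, p (rotate g x) := by
  have h1 := ae_ae_rotate_prod (Measure.quasiMeasurePreserving_fst.ae h)
  have hne : ((surfaceMeasure d).prod (surfaceMeasure d)) ≠ 0 := by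
    intro h0
    have := isOpen_univ.measure_ne_zero ((surfaceMeasure d).prod (surfaceMeasure d)) ⟨(x, x), mem_univ _⟩
    simp [h0] at this
  have := ae_neBot.2 hne
  obtain ⟨q, hq⟩ := h1.exists
  obtain ⟨k, rfl⟩ := exists_rotate_eq_left q.1 x
  exact (ae_rotate_mul_right hq k)

/-! ### Continuity in measure and the rectangle relation -/

/-- For a measurable function on the sphere, `x ↦ (g ↦ f (g x))` is continuous in measure. -/
theorem exists_strictMono_ae_tendsto_rotate {d : ℕ} {f : UnitSphere d → ℂ} (hf : Measurable f)
    {z : ℕ → UnitSphere d} {z₀ : UnitSphere d} (hz : Tendsto z atTop (𝓝 z₀)) :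
    ∃ φ : ℕ → ℕ, StrictMono φ ∧ ∀ᵐ g ∂rotationMeasure d,
      Tendsto (fun n => f (rotate g (z (φ n)))) atTop (𝓝 (f (rotate g z₀))) := by
  set ν := (rotationMeasure d).map fun g => rotate g z₀ with hν
  have hfin : IsFiniteMeasure ν := by rw [hν]; infer_instance
  -- Compressing ℂ to the unit ball makes f integrable without losing convergence. Composition with
  -- measure preserving maps is continuous in L¹, and L¹ convergence gives an almost everywhere
  -- convergent subsequence.
  let b : ℂ → ℂ := fun w => (Homeomorph.unitBall w : ℂ)
  have hb : Continuous b := continuous_subtype_val.comp Homeomorph.unitBall.continuous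
  have hbm : MemLp (fun x => b (f x)) 1 ν := by
    refine MemLp.of_bound (hb.measurable.comp hf).aestronglyMeasurable 1 (Eventually.of_forall fun x => ?_)
    exact (mem_ball_zero_iff.1 (Homeomorph.unitBall (f x)).2).le
  let T : UnitSphere d → C(RotationGroup d, UnitSphere d) := fun x =>
    ⟨fun g => rotate g x, continuous_rotate_left x⟩
  have hT : Continuous T := by
    refine ContinuousMap.continuous_of_continuous_uncurry _ ?_
    exact continuous_rotate.comp continuous_swap
  have hTm : ∀ x, MeasurePreserving (T x) (rotationMeasure d) ν := fun x =>
    ⟨measurable_rotate_left x, map_rotate_eq x z₀⟩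
  have hlim := (tendsto_const_nhds (x := hbm.toLp _) (f := (atTop : Filter ℕ))).compMeasurePreservingLp
    ((hT.tendsto z₀).comp hz) (fun n => hTm (z n)) (hTm z₀) ENNReal.one_ne_top
  obtain ⟨φ, hφ, hφ2⟩ := (tendstoInMeasure_of_tendsto_Lp hlim).exists_seq_tendsto_ae
  refine ⟨φ, hφ, ?_⟩
  have hval : ∀ x, ∀ᵐ g ∂rotationMeasure d,
      (Lp.compMeasurePreserving (T x) (hTm x) (hbm.toLp _)) g = b (f (rotate g x)) := by
    intro x
    have h1 := Lp.coeFn_compMeasurePreserving (hbm.toLp _) (hTm x)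
    have h2 := (hTm x).quasiMeasurePreserving.ae hbm.coeFn_toLp
    filter_upwards [h1, h2] with g h1 h2
    rw [h1]
    exact h2
  have hall : ∀ᵐ g ∂rotationMeasure d, ∀ n : ℕ,
      (Lp.compMeasurePreserving (T (z n)) (hTm (z n)) (hbm.toLp _)) g = b (f (rotate g (z n))) :=
    ae_all_iff.2 fun n => hval (z n)
  filter_upwards [hφ2, hall, hval z₀] with g h1 h2 h3
  have h4 : Tendsto (fun n => b (f (rotate g (z (φ n))))) atTop (𝓝 (b (f (rotate g z₀)))) := by
    rw [← h3]
    refine h1.congr fun n => ?_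
    exact h2 (φ n)
  have h5 : Tendsto (fun n => Homeomorph.unitBall (f (rotate g (z (φ n))))) atTop
      (𝓝 (Homeomorph.unitBall (f (rotate g z₀)))) := tendsto_subtype_rng.2 h4
  have h6 := (Homeomorph.unitBall.symm.continuous.tendsto _).comp h5
  simpa [Function.comp_def] using h6

theorem exists_norm_eq_one_inner_eq_zero {d : ℕ} (hd : 3 ≤ d) (u v : EuclideanSpace ℝ (Fin d)) :
    ∃ n : EuclideanSpace ℝ (Fin d), ‖n‖ = 1 ∧ inner ℝ u n = 0 ∧ inner ℝ v n = 0 := by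
  set K : Submodule ℝ (EuclideanSpace ℝ (Fin d)) := Submodule.span ℝ {u, v} with hK
  have hK2 : Module.finrank ℝ K ≤ 2 := by
    have := finrank_span_finset_le_card (R := ℝ) ({u, v} : Finset (EuclideanSpace ℝ (Fin d)))
    simp only [Finset.coe_insert, Finset.coe_singleton] at this
    exact this.trans Finset.card_le_two
  have hne : Kᗮ ≠ ⊥ := by
    intro h
    rw [Submodule.orthogonal_eq_bot_iff] at h
    rw [h, finrank_top, finrank_euclideanSpace_fin] at hK2
    omega
  obtain ⟨n, hn, hn0⟩ := Submodule.exists_mem_ne_zero_of_ne_bot hne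
  have hu : inner ℝ u n = 0 := (Submodule.mem_orthogonal K n).1 hn u
    (Submodule.subset_span (by simp))
  have hv : inner ℝ v n = 0 := (Submodule.mem_orthogonal K n).1 hn v
    (Submodule.subset_span (by simp))
  refine ⟨(‖n‖⁻¹ : ℝ) • n, ?_, ?_, ?_⟩
  · rw [norm_smul, norm_inv, norm_norm, inv_mul_cancel₀ (norm_ne_zero_iff.2 hn0)]
  · rw [inner_smul_right, hu, mul_zero]
  · rw [inner_smul_right, hv, mul_zero]

theorem ae_of_ae_rotate {d : ℕ} {p : UnitSphere d → Prop} (g : RotationGroup d)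
    (h : ∀ᵐ x ∂surfaceMeasure d, p (rotate g x)) : ∀ᵐ x ∂surfaceMeasure d, p x := by
  filter_upwards [(measurePreserving_rotate g⁻¹).quasiMeasurePreserving.ae h] with x hx
  rwa [← rotate_mul, mul_inv_cancel, show rotate (1 : RotationGroup d) x = x from rfl] at hx

/-- The relation `f(gx)f(gy) = f(gx')f(gy')` for almost all `g` is closed. -/
theorem ae_rotate_mul_eq_of_tendsto {d : ℕ} {f : UnitSphere d → ℂ} (hf : Measurable f)
    {a b a' b' : ℕ → UnitSphere d} {x y x' y' : UnitSphere d} (ha : Tendsto a atTop (𝓝 x))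
    (hb : Tendsto b atTop (𝓝 y)) (ha' : Tendsto a' atTop (𝓝 x')) (hb' : Tendsto b' atTop (𝓝 y'))
    (h : ∀ n, ∀ᵐ g ∂rotationMeasure d,
      f (rotate g (a n)) * f (rotate g (b n)) = f (rotate g (a' n)) * f (rotate g (b' n))) :
    ∀ᵐ g ∂rotationMeasure d,
      f (rotate g x) * f (rotate g y) = f (rotate g x') * f (rotate g y') := by
  obtain ⟨φ₁, hφ₁, h1⟩ := exists_strictMono_ae_tendsto_rotate hf ha
  obtain ⟨φ₂, hφ₂, h2⟩ := exists_strictMono_ae_tendsto_rotate hf (hb.comp hφ₁.tendsto_atTop)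
  obtain ⟨φ₃, hφ₃, h3⟩ := exists_strictMono_ae_tendsto_rotate hf
    (ha'.comp (hφ₁.tendsto_atTop.comp hφ₂.tendsto_atTop))
  obtain ⟨φ₄, hφ₄, h4⟩ := exists_strictMono_ae_tendsto_rotate hf
    (hb'.comp (hφ₁.tendsto_atTop.comp (hφ₂.tendsto_atTop.comp hφ₃.tendsto_atTop)))
  filter_upwards [h1, h2, h3, h4, ae_all_iff.2 h] with g h1 h2 h3 h4 h
  have h1' := h1.comp (hφ₂.tendsto_atTop.comp (hφ₃.tendsto_atTop.comp hφ₄.tendsto_atTop))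
  have h2' := h2.comp (hφ₃.tendsto_atTop.comp hφ₄.tendsto_atTop)
  have h3' := h3.comp hφ₄.tendsto_atTop
  refine tendsto_nhds_unique (h1'.mul h2') ((h3'.mul h4).congr fun n => ?_)
  exact (h _).symm

section Rectangle

variable {d : ℕ} {f : UnitSphere d → ℂ} {H : EuclideanSpace ℝ (Fin d) → ℂ}

/-- The reflection along e = x - x' fixes x + y and sends (x, y) to (x', y'). Approximate (x, y) by
pairs satisfying the equation with `H` for almost all rotations, and make e orthogonal to their
sums: the perturbed reflections fix these sums, so the relation holds for them and passes to the
limit. The sum must be nonzero for the corrected vectors to converge to e. -/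
theorem ae_rotate_mul_eq_of_add_ne_zero (hf : Measurable f)
    (hH : ∀ᵐ q ∂((surfaceMeasure d).prod (surfaceMeasure d)), f q.1 * f q.2 =
      H ((q.1 : EuclideanSpace ℝ (Fin d)) + (q.2 : EuclideanSpace ℝ (Fin d))))
    {x y x' y' : UnitSphere d} (hadd : (x : EuclideanSpace ℝ (Fin d)) + y = x' + y')
    (hne : (x : EuclideanSpace ℝ (Fin d)) + y ≠ 0) :
    ∀ᵐ g ∂rotationMeasure d,
      f (rotate g x) * f (rotate g y) = f (rotate g x') * f (rotate g y') := by
  by_cases hxx : x = x'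
  · subst hxx
    have : y = y' := Subtype.ext (add_left_cancel hadd)
    subst this
    exact Eventually.of_forall fun _ => rfl
  have hgood := ae_ae_rotate_prod hH
  have hdense := Measure.dense_of_ae hgood
  obtain ⟨q, hq, hqlim⟩ := mem_closure_iff_seq_limit.1 (hdense (x, y))
  have hq1 : Tendsto (fun n => (q n).1) atTop (𝓝 x) := (continuous_fst.tendsto _).comp hqlim
  have hq2 : Tendsto (fun n => (q n).2) atTop (𝓝 y) := (continuous_snd.tendsto _).comp hqlim
  have hv1 : Tendsto (fun n => ((q n).1 : EuclideanSpace ℝ (Fin d))) atTop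
      (𝓝 (x : EuclideanSpace ℝ (Fin d))) := (continuous_subtype_val.tendsto _).comp hq1
  have hv2 : Tendsto (fun n => ((q n).2 : EuclideanSpace ℝ (Fin d))) atTop
      (𝓝 (y : EuclideanSpace ℝ (Fin d))) := (continuous_subtype_val.tendsto _).comp hq2
  set e : EuclideanSpace ℝ (Fin d) :=
    (x : EuclideanSpace ℝ (Fin d)) - (x' : EuclideanSpace ℝ (Fin d)) with he
  have he0 : e ≠ 0 := fun h => hxx (Subtype.ext (sub_eq_zero.1 h))
  have hey : e = (y' : EuclideanSpace ℝ (Fin d)) - (y : EuclideanSpace ℝ (Fin d)) := by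
    rw [he, sub_eq_sub_iff_add_eq_add, hadd, add_comm]
  set s : EuclideanSpace ℝ (Fin d) :=
    (x : EuclideanSpace ℝ (Fin d)) + (y : EuclideanSpace ℝ (Fin d)) with hs
  have hse : inner ℝ s e = 0 := by
    have hx1 : inner ℝ (x : EuclideanSpace ℝ (Fin d)) (x : EuclideanSpace ℝ (Fin d)) = 1 := by simp
    have hx2 : inner ℝ (x' : EuclideanSpace ℝ (Fin d)) (x' : EuclideanSpace ℝ (Fin d)) = 1 := by simp
    have hy1 : inner ℝ (y : EuclideanSpace ℝ (Fin d)) (y : EuclideanSpace ℝ (Fin d)) = 1 := by simp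
    have hy2 : inner ℝ (y' : EuclideanSpace ℝ (Fin d)) (y' : EuclideanSpace ℝ (Fin d)) = 1 := by simp
    have e1 : inner ℝ ((x : EuclideanSpace ℝ (Fin d)) + (x' : EuclideanSpace ℝ (Fin d))) e = 0 := by
      rw [he]
      simp only [inner_add_left, inner_sub_right, hx1, hx2,
        real_inner_comm (x : EuclideanSpace ℝ (Fin d)) (x' : EuclideanSpace ℝ (Fin d))]
      ring
    have e2 : inner ℝ ((y : EuclideanSpace ℝ (Fin d)) + (y' : EuclideanSpace ℝ (Fin d))) e = 0 := by
      rw [hey]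
      simp only [inner_add_left, inner_sub_right, hy1, hy2,
        real_inner_comm (y : EuclideanSpace ℝ (Fin d)) (y' : EuclideanSpace ℝ (Fin d))]
      ring
    have e3 : (2 : ℝ) • s = ((x : EuclideanSpace ℝ (Fin d)) + (x' : EuclideanSpace ℝ (Fin d))) +
        ((y : EuclideanSpace ℝ (Fin d)) + (y' : EuclideanSpace ℝ (Fin d))) := by
      calc (2 : ℝ) • s = s + s := two_smul _ _
        _ = ((x : EuclideanSpace ℝ (Fin d)) + (y : EuclideanSpace ℝ (Fin d))) +
            ((x' : EuclideanSpace ℝ (Fin d)) + (y' : EuclideanSpace ℝ (Fin d))) := by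
          rw [← hadd]
        _ = _ := by abel
    have e4 : inner ℝ ((2 : ℝ) • s) e = 0 := by rw [e3, inner_add_left, e1, e2, add_zero]
    rw [real_inner_smul_left] at e4
    linarith
  let t : ℕ → EuclideanSpace ℝ (Fin d) := fun n =>
    ((q n).1 : EuclideanSpace ℝ (Fin d)) + ((q n).2 : EuclideanSpace ℝ (Fin d))
  have ht : Tendsto t atTop (𝓝 s) := hv1.add hv2
  let E : ℕ → EuclideanSpace ℝ (Fin d) := fun n => e - (inner ℝ (t n) e / ‖t n‖ ^ 2) • t n
  have hE : Tendsto E atTop (𝓝 e) := by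
    have h1 : Tendsto E atTop (𝓝 (e - (inner ℝ s e / ‖s‖ ^ 2) • s)) :=
      tendsto_const_nhds.sub (((ht.inner tendsto_const_nhds).div (ht.norm.pow 2)
        (by simpa using hne)).smul ht)
    simpa [hse] using h1
  have hrefl : ∀ {w : ℕ → UnitSphere d} {w₀ : UnitSphere d}, Tendsto w atTop (𝓝 w₀) →
      Tendsto (fun n => rotate (hyperplaneReflection (E n)) (w n)) atTop
        (𝓝 (rotate (hyperplaneReflection e) w₀)) := by
    intro w w₀ hw
    refine tendsto_subtype_rng.2 ?_
    simp only [coe_rotate, hyperplaneReflection_apply]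
    have hw' : Tendsto (fun n => (w n : EuclideanSpace ℝ (Fin d))) atTop
      (𝓝 (w₀ : EuclideanSpace ℝ (Fin d))) := (continuous_subtype_val.tendsto _).comp hw
    exact hw'.sub ((((hE.inner hw').const_mul 2).div (hE.norm.pow 2) (by simpa using he0)).smul hE)
  have hfix : ∀ n, (hyperplaneReflection (E n) :
      EuclideanSpace ℝ (Fin d) →L[ℝ] EuclideanSpace ℝ (Fin d)) (t n) = t n := by
    intro n
    have h0 : inner ℝ (E n) (t n) = 0 := by
      simp only [E, inner_sub_left, real_inner_smul_left, real_inner_self_eq_norm_sq,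
        real_inner_comm (t n) e]
      by_cases h : t n = 0
      · simp [h]
      · have : ‖t n‖ ≠ 0 := norm_ne_zero_iff.2 h
        field_simp
        ring
    rw [hyperplaneReflection_apply, h0]
    simp
  have hx' : rotate (hyperplaneReflection e) x = x' := by
    refine Subtype.ext (hyperplaneReflection_sub ?_)
    rw [norm_eq_of_mem_sphere, norm_eq_of_mem_sphere]
  have hy' : rotate (hyperplaneReflection e) y = y' := by
    refine Subtype.ext ?_
    have h1 : (hyperplaneReflection e :
      EuclideanSpace ℝ (Fin d) →L[ℝ] EuclideanSpace ℝ (Fin d)) s = s := by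
      rw [hyperplaneReflection_apply, real_inner_comm, hse]
      simp
    have h2 := congrArg Subtype.val hx'
    rw [coe_rotate] at h2 ⊢
    rw [hs, map_add, h2, ← hs, hadd] at h1
    exact add_left_cancel h1
  have lim1 := hrefl hq1
  have lim2 := hrefl hq2
  rw [hx'] at lim1
  rw [hy'] at lim2
  refine ae_rotate_mul_eq_of_tendsto hf hq1 hq2 lim1 lim2 fun n => ?_
  have h1 := hq n
  filter_upwards [h1, ae_rotate_mul_right h1 (hyperplaneReflection (E n))] with g h1 h2
  rw [h1]
  simp only [rotate_mul] at h2
  rw [h2]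
  congr 1
  simp only [coe_rotate]
  rw [← map_add, ← map_add, ← map_add, hfix n]

/-- In dimension at least three, the product of the values of a solution at two points depends, in
the sense of almost all rotations, only on the sum of these points. -/
theorem ae_rotate_mul_eq_of_add_eq (hd : 3 ≤ d) (hf : Measurable f)
    (hH : ∀ᵐ q ∂((surfaceMeasure d).prod (surfaceMeasure d)), f q.1 * f q.2 =
      H ((q.1 : EuclideanSpace ℝ (Fin d)) + (q.2 : EuclideanSpace ℝ (Fin d))))
    {x y x' y' : UnitSphere d} (hadd : (x : EuclideanSpace ℝ (Fin d)) + y = x' + y') :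
    ∀ᵐ g ∂rotationMeasure d,
      f (rotate g x) * f (rotate g y) = f (rotate g x') * f (rotate g y') := by
  by_cases hne : (x : EuclideanSpace ℝ (Fin d)) + y = 0
  swap
  · exact ae_rotate_mul_eq_of_add_ne_zero hf hH hadd hne
  -- Antipodal pairs: tilting all four points by an angle t towards a common normal n keeps the two
  -- sums equal and makes them 2 sin t · n ≠ 0; then t → 0.
  obtain ⟨n, hn1, hn2, hn3⟩ := exists_norm_eq_one_inner_eq_zero hd
    (x : EuclideanSpace ℝ (Fin d)) (x' : EuclideanSpace ℝ (Fin d))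
  have hy : (y : EuclideanSpace ℝ (Fin d)) = -x := (neg_eq_of_add_eq_zero_right hne).symm
  have hy' : (y' : EuclideanSpace ℝ (Fin d)) = -x' := by
    rw [hadd] at hne
    exact (neg_eq_of_add_eq_zero_right hne).symm
  have hmem : ∀ (z : UnitSphere d), inner ℝ (z : EuclideanSpace ℝ (Fin d)) n = 0 → ∀ t : ℝ,
      Real.cos t • (z : EuclideanSpace ℝ (Fin d)) + Real.sin t • n ∈ sphere (0 : EuclideanSpace ℝ (Fin d)) 1 := by
    intro z hz t
    rw [mem_sphere_zero_iff_norm]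
    have h1 : ‖Real.cos t • (z : EuclideanSpace ℝ (Fin d)) + Real.sin t • n‖ ^ 2 = 1 := by
      rw [norm_add_sq_real, norm_smul, norm_smul, hn1, norm_eq_of_mem_sphere, real_inner_smul_left,
        real_inner_smul_right, hz]
      simp
    nlinarith [norm_nonneg (Real.cos t • (z : EuclideanSpace ℝ (Fin d)) + Real.sin t • n)]
  let c : ∀ (z : UnitSphere d), inner ℝ (z : EuclideanSpace ℝ (Fin d)) n = 0 → ℝ → UnitSphere d :=
    fun z hz t => ⟨_, hmem z hz t⟩
  have hyn : inner ℝ (y : EuclideanSpace ℝ (Fin d)) n = 0 := by rw [hy, inner_neg_left, hn2, neg_zero]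
  have hyn' : inner ℝ (y' : EuclideanSpace ℝ (Fin d)) n = 0 := by
    rw [hy', inner_neg_left, hn3, neg_zero]
  have hlim : ∀ z hz, Tendsto (fun k : ℕ => c z hz (1 / ((k : ℝ) + 1))) atTop (𝓝 z) := by
    intro z hz
    have h1 : Continuous (c z hz) := by
      refine Continuous.subtype_mk ?_ _
      fun_prop
    have h2 : c z hz 0 = z := Subtype.ext (by simp [c])
    have h3 := (h1.tendsto 0).comp (tendsto_one_div_add_atTop_nhds_zero_nat (𝕜 := ℝ))
    rwa [h2] at h3
  refine ae_rotate_mul_eq_of_tendsto hf (hlim x hn2) (hlim y hyn) (hlim x' hn3) (hlim y' hyn')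
    fun k => ?_
  set t : ℝ := 1 / ((k : ℝ) + 1) with ht
  have ht0 : 0 < t := by positivity
  have ht1 : t ≤ 1 := by
    rw [ht, div_le_one (by positivity)]
    linarith [(Nat.cast_nonneg k : (0 : ℝ) ≤ k)]
  have hsum : ∀ z w : EuclideanSpace ℝ (Fin d), w = -z →
      (Real.cos t • z + Real.sin t • n) + (Real.cos t • w + Real.sin t • n) =
        (2 * Real.sin t) • n := by
    rintro z w rfl
    rw [smul_neg, two_mul, add_smul]
    abel
  refine ae_rotate_mul_eq_of_add_ne_zero hf hH ?_ ?_
  · simp only [c]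
    rw [hsum _ _ hy, hsum _ _ hy']
  · simp only [c]
    rw [hsum _ _ hy]
    have : 0 < Real.sin t := Real.sin_pos_of_pos_of_lt_pi ht0 (by linarith [Real.pi_gt_three])
    refine smul_ne_zero (by positivity) fun h => ?_
    simp [h] at hn1

end Rectangle

/-! ### The support is null or conull in dimension at least three -/

theorem exists_isometric_frame {d : ℕ} (hd : 3 ≤ d) :
    ∃ T : ℝ → ℝ → ℝ → EuclideanSpace ℝ (Fin d),
      (∀ a b c, ‖T a b c‖ ^ 2 = a ^ 2 + b ^ 2 + c ^ 2) ∧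
      (∀ a b c a' b' c', T a b c + T a' b' c' = T (a + a') (b + b') (c + c')) ∧
      (∀ a b c a' b' c', T a b c - T a' b' c' = T (a - a') (b - b') (c - c')) := by
  let i : Fin d := ⟨0, by omega⟩
  let j : Fin d := ⟨1, by omega⟩
  let k : Fin d := ⟨2, by omega⟩
  have hij : i ≠ j := by simp [i, j]
  have hik : i ≠ k := by simp [i, k]
  have hjk : j ≠ k := by simp [j, k]
  refine ⟨fun a b c => EuclideanSpace.single i a + EuclideanSpace.single j b +
    EuclideanSpace.single k c, fun a b c => ?_, fun a b c a' b' c' => ?_,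
    fun a b c a' b' c' => ?_⟩
  · rw [← real_inner_self_eq_norm_sq]
    simp only [inner_add_left, inner_add_right, EuclideanSpace.inner_single_left]
    simp [hij, hik, hjk, hij.symm, hik.symm, hjk.symm]
    ring
  · ext l
    simp
    split_ifs <;> ring
  · ext l
    simp
    split_ifs <;> ring

section Correlation

variable {d : ℕ} {f : UnitSphere d → ℂ}

/-- The measure of the set of rotations at which `f` vanishes at neither image of two points. -/
noncomputable def supportCorrelation (f : UnitSphere d → ℂ) (x y : UnitSphere d) : ℝ≥0∞ :=
  rotationMeasure d {g | f (rotate g x) ≠ 0 ∧ f (rotate g y) ≠ 0}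

theorem measurableSet_rotate_ne_zero (hf : Measurable f) (x : UnitSphere d) :
    MeasurableSet {g : RotationGroup d | f (rotate g x) ≠ 0} :=
  (hf.comp (measurable_rotate_left x)) (measurableSet_singleton 0).compl

theorem supportCorrelation_congr (hf : Measurable f) {x y x' y' : UnitSphere d}
    (h : dist x y = dist x' y') : supportCorrelation f x y = supportCorrelation f x' y' := by
  obtain ⟨k, rfl, rfl⟩ := exists_rotate_eq h
  have h1 := (measurePreserving_mul_right (rotationMeasure d) k).measure_preimage
    (((measurableSet_rotate_ne_zero hf x).inter
      (measurableSet_rotate_ne_zero hf y)).nullMeasurableSet)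
  exact h1.symm

theorem supportCorrelation_mono {x y z : UnitSphere d}
    (h : ∀ᵐ g ∂rotationMeasure d, f (rotate g x) ≠ 0 → f (rotate g y) ≠ 0 → f (rotate g z) ≠ 0) :
    supportCorrelation f x y ≤ supportCorrelation f x z := by
  refine measure_mono_ae ?_
  filter_upwards [h] with g hg hxy
  exact ⟨hxy.1, hg hxy.1 hxy.2⟩

/-- Points at distance t are opposite vertices of rectangles inscribed in a circle of radius t/2. A
third vertex B can be placed at any distance u ≤ t from X, and nonvanishing at X and Y forces
nonvanishing at B. -/
theorem supportCorrelation_anti (hd : 3 ≤ d) (hf : Measurable f)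
    (hrect : ∀ x y x' y' : UnitSphere d, (x : EuclideanSpace ℝ (Fin d)) + y = x' + y' →
      ∀ᵐ g ∂rotationMeasure d, f (rotate g x) ≠ 0 → f (rotate g y) ≠ 0 → f (rotate g x') ≠ 0)
    {x y x' y' : UnitSphere d} (h : dist x' y' ≤ dist x y) :
    supportCorrelation f x y ≤ supportCorrelation f x' y' := by
  obtain ⟨T, hT, hTa, hTs⟩ := exists_isometric_frame hd
  set t := dist x y with ht
  set u := dist x' y' with hu
  have hu0 : 0 ≤ u := dist_nonneg
  rcases (dist_nonneg (x := x) (y := y)).eq_or_lt' with h0 | h0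
  · refine (supportCorrelation_congr hf ?_).le
    rw [← ht, ← hu]
    linarith
  have ht2 : t ≤ 2 := by
    rw [ht, Subtype.dist_eq]
    refine (dist_le_norm_add_norm _ _).trans ?_
    rw [norm_eq_of_mem_sphere, norm_eq_of_mem_sphere]
    norm_num
  set ρ := t / 2 with hρ
  have hρ0 : 0 < ρ := by rw [hρ]; exact half_pos h0
  have hρ1 : ρ ≤ 1 := by rw [hρ]; linarith
  set γ := √(1 - ρ ^ 2) with hγ
  have hγ2 : γ ^ 2 = 1 - ρ ^ 2 := Real.sq_sqrt (by nlinarith)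
  -- `c` and `s` are the cosine and sine of the angle between X and B on this circle, so that u² =
  -- 2ρ²(1 - c).
  set c := 1 - u ^ 2 / (2 * ρ ^ 2) with hc
  have hcu : u ^ 2 = ρ ^ 2 * (2 * (1 - c)) := by rw [hc]; field_simp; ring
  have hc1 : c ≤ 1 := by rw [hc]; have : 0 ≤ u ^ 2 / (2 * ρ ^ 2) := by positivity
                         linarith
  have hc2 : -1 ≤ c := by
    have : u ≤ 2 * ρ := by rw [hρ]; linarith
    have h4 : u ^ 2 ≤ 4 * ρ ^ 2 := by nlinarith
    have h5 : 0 < ρ ^ 2 := by positivity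
    nlinarith
  set s := √(1 - c ^ 2) with hs
  have hs2 : s ^ 2 = 1 - c ^ 2 := Real.sq_sqrt (by nlinarith)
  have hmem : ∀ a b c, a ^ 2 + b ^ 2 + c ^ 2 = 1 → T a b c ∈ sphere (0 : EuclideanSpace ℝ (Fin d)) 1 := by
    intro a b c h
    rw [mem_sphere_zero_iff_norm]
    have := hT a b c
    nlinarith [norm_nonneg (T a b c)]
  have hdist : ∀ a b c a' b' c' h h', dist (⟨T a b c, h⟩ : UnitSphere d) ⟨T a' b' c', h'⟩ =
      √((a - a') ^ 2 + (b - b') ^ 2 + (c - c') ^ 2) := by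
    intro a b c a' b' c' h h'
    rw [Subtype.dist_eq, dist_eq_norm, hTs, ← hT, Real.sqrt_sq (norm_nonneg _)]
  let X : UnitSphere d := ⟨T γ ρ 0, hmem _ _ _ (by rw [hγ2]; ring)⟩
  let Y : UnitSphere d := ⟨T γ (-ρ) 0, hmem _ _ _ (by rw [hγ2]; ring)⟩
  let B : UnitSphere d := ⟨T γ (ρ * c) (ρ * s), hmem _ _ _ (by rw [hγ2, mul_pow, mul_pow, hs2]; ring)⟩
  let B' : UnitSphere d := ⟨T γ (-(ρ * c)) (-(ρ * s)),
    hmem _ _ _ (by rw [neg_sq, neg_sq, hγ2, mul_pow, mul_pow, hs2]; ring)⟩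
  have hXY : dist X Y = t := by
    rw [hdist, show (γ - γ) ^ 2 + (ρ - -ρ) ^ 2 + ((0 : ℝ) - 0) ^ 2 = t ^ 2 by rw [hρ]; ring,
      Real.sqrt_sq h0.le]
  have hXB : dist X B = u := by
    rw [hdist, show (γ - γ) ^ 2 + (ρ - ρ * c) ^ 2 + ((0 : ℝ) - ρ * s) ^ 2 = u ^ 2 by
      rw [hcu]; linear_combination ρ ^ 2 * hs2, Real.sqrt_sq hu0]
  rw [supportCorrelation_congr hf (x := x) (y := y) (x' := X) (y' := Y) (by rw [hXY]),
    supportCorrelation_congr hf (x := x') (y := y') (x' := X) (y' := B) (by rw [hXB])]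
  refine supportCorrelation_mono (hrect X Y B B' ?_)
  simp only [X, Y, B, B', hTa]
  congr 1 <;> ring

/-- Two rectangles in succession increase the distance. Nonvanishing at X and Y passes to X', a
vertex of a square with diagonal XY, and then from X' and Y to Z, a vertex of a square with diagonal
X'Y on the side away from X. In the flat limit |XZ|² = 5ρ² against |XY|² = 4ρ²; for t ≤ 1 curvature
still leaves the factor 6/5. -/
theorem exists_supportCorrelation_le (hd : 3 ≤ d) (hf : Measurable f)
    (hrect : ∀ x y x' y' : UnitSphere d, (x : EuclideanSpace ℝ (Fin d)) + y = x' + y' →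
      ∀ᵐ g ∂rotationMeasure d, f (rotate g x) ≠ 0 → f (rotate g y) ≠ 0 → f (rotate g x') ≠ 0)
    {x y : UnitSphere d} (h : dist x y ≤ 1) :
    ∃ x' y' : UnitSphere d, (6 / 5) * dist x y ^ 2 ≤ dist x' y' ^ 2 ∧
      supportCorrelation f x y ≤ supportCorrelation f x' y' := by
  obtain ⟨T, hT, hTa, hTs⟩ := exists_isometric_frame hd
  set t := dist x y with ht
  have h0 : 0 ≤ t := dist_nonneg
  set ρ := t / 2 with hρ
  have hρ0 : 0 ≤ ρ := by rw [hρ]; linarith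
  have hρ1 : ρ ≤ 1 / 2 := by rw [hρ]; linarith
  have hρ2 : ρ ^ 2 ≤ 1 / 4 := by nlinarith
  set γ := √(1 - ρ ^ 2) with hγ
  have hγ2 : γ ^ 2 = 1 - ρ ^ 2 := Real.sq_sqrt (by nlinarith)
  have hγ0 : 0 < γ := Real.sqrt_pos.2 (by nlinarith)
  -- `a`, `b`, `c` solve |Z| = |Z'| = 1 for Z = (a, b, b) and Z' = X' + Y - Z. Then |XZ|² = ρ²(3 +
  -- 2c), and c ≥ 9/10 gives exactly (6/5)(2ρ)².
  set c := √((2 - 2 * ρ ^ 2) / (2 - ρ ^ 2)) with hc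
  have hden : 0 < 2 - ρ ^ 2 := by nlinarith
  have hc2 : c ^ 2 = (2 - 2 * ρ ^ 2) / (2 - ρ ^ 2) := Real.sq_sqrt (div_nonneg (by nlinarith) hden.le)
  have hc2' : c ^ 2 * (2 - ρ ^ 2) = 2 - 2 * ρ ^ 2 := by rw [hc2]; field_simp
  have hc9 : 9 / 10 ≤ c := by
    refine Real.le_sqrt_of_sq_le ?_
    rw [le_div_iff₀ hden]
    nlinarith
  set b := ρ * (1 + c) / 2 with hb
  set a := (1 - ρ ^ 2 / 2 - b * ρ) / γ with ha
  have ha' : a * γ = 1 - ρ ^ 2 / 2 - b * ρ := by rw [ha]; field_simp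
  have hab : a ^ 2 + b ^ 2 + b ^ 2 = 1 := by
    have h1 : (a ^ 2 + b ^ 2 + b ^ 2) * γ ^ 2 = 1 * γ ^ 2 := by
      have : (a ^ 2 + b ^ 2 + b ^ 2) * γ ^ 2 = (a * γ) ^ 2 + 2 * b ^ 2 * γ ^ 2 := by ring
      rw [this, ha', hγ2, hb]
      linear_combination (ρ ^ 2 / 4) * hc2'
    exact mul_right_cancel₀ (by positivity) h1
  have hmem : ∀ a b c, a ^ 2 + b ^ 2 + c ^ 2 = 1 → T a b c ∈ sphere (0 : EuclideanSpace ℝ (Fin d)) 1 := by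
    intro a b c h
    rw [mem_sphere_zero_iff_norm]
    have := hT a b c
    nlinarith [norm_nonneg (T a b c)]
  have hdist : ∀ a b c a' b' c' h h', dist (⟨T a b c, h⟩ : UnitSphere d) ⟨T a' b' c', h'⟩ =
      √((a - a') ^ 2 + (b - b') ^ 2 + (c - c') ^ 2) := by
    intro a b c a' b' c' h h'
    rw [Subtype.dist_eq, dist_eq_norm, hTs, ← hT, Real.sqrt_sq (norm_nonneg _)]
  let X : UnitSphere d := ⟨T γ (-ρ) 0, hmem _ _ _ (by rw [hγ2]; ring)⟩
  let Y : UnitSphere d := ⟨T γ ρ 0, hmem _ _ _ (by rw [hγ2]; ring)⟩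
  let X' : UnitSphere d := ⟨T γ 0 ρ, hmem _ _ _ (by rw [hγ2]; ring)⟩
  let Y' : UnitSphere d := ⟨T γ 0 (-ρ), hmem _ _ _ (by rw [hγ2]; ring)⟩
  let Z : UnitSphere d := ⟨T a b b, hmem _ _ _ hab⟩
  let Z' : UnitSphere d := ⟨T (2 * γ - a) (ρ - b) (ρ - b), hmem _ _ _ (by
    linear_combination hab - 4 * ha' + 4 * hγ2)⟩
  have hXY : dist X Y = t := by
    rw [hdist, show (γ - γ) ^ 2 + (-ρ - ρ) ^ 2 + ((0 : ℝ) - 0) ^ 2 = t ^ 2 by rw [hρ]; ring,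
      Real.sqrt_sq h0]
  refine ⟨X, Z, ?_, ?_⟩
  · rw [hdist, Real.sq_sqrt (by positivity)]
    have : (γ - a) ^ 2 + (-ρ - b) ^ 2 + (0 - b) ^ 2 = ρ ^ 2 * (3 + 2 * c) := by
      rw [show ρ ^ 2 * (3 + 2 * c) = ρ ^ 2 + 4 * (b * ρ) by rw [hb]; ring]
      linear_combination hab - 2 * ha' + hγ2
    rw [this, show t = 2 * ρ by rw [hρ]; ring]
    nlinarith [sq_nonneg ρ]
  · rw [supportCorrelation_congr hf (x := x) (y := y) (x' := X) (y' := Y) (by rw [hXY])]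
    refine supportCorrelation_mono ?_
    have h1 := hrect X Y X' Y' (by
      simp only [X, Y, X', Y', hTa]
      congr 1 <;> ring)
    have h2 := hrect X' Y Z Z' (by
      simp only [X', Y, Z, Z', hTa]
      congr 1 <;> ring)
    filter_upwards [h1, h2] with g h1 h2 hX hY
    exact h2 (h1 hX hY) hY

/-- The support of a function is null or conull if it is stable, in the sense of almost all
rotations, under completing rectangles. -/
theorem ae_ne_zero_of_rectangle (hd : 3 ≤ d) (hf : Measurable f)
    (hrect : ∀ x y x' y' : UnitSphere d, (x : EuclideanSpace ℝ (Fin d)) + y = x' + y' →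
      ∀ᵐ g ∂rotationMeasure d, f (rotate g x) ≠ 0 → f (rotate g y) ≠ 0 → f (rotate g x') ≠ 0)
    (hf0 : ¬ ∀ᵐ x ∂surfaceMeasure d, f x = 0) : ∀ᵐ x ∂surfaceMeasure d, f x ≠ 0 := by
  obtain ⟨T, hT, hTa, hTs⟩ := exists_isometric_frame hd
  have hmem : ∀ a b c, a ^ 2 + b ^ 2 + c ^ 2 = 1 → T a b c ∈ sphere (0 : EuclideanSpace ℝ (Fin d)) 1 := by
    intro a b c h
    rw [mem_sphere_zero_iff_norm]
    have := hT a b c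
    nlinarith [norm_nonneg (T a b c)]
  have hdist : ∀ a b c a' b' c' h h', dist (⟨T a b c, h⟩ : UnitSphere d) ⟨T a' b' c', h'⟩ =
      √((a - a') ^ 2 + (b - b') ^ 2 + (c - c') ^ 2) := by
    intro a b c a' b' c' h h'
    rw [Subtype.dist_eq, dist_eq_norm, hTs, ← hT, Real.sqrt_sq (norm_nonneg _)]
  let x₁ : UnitSphere d := ⟨T 1 0 0, hmem _ _ _ (by norm_num)⟩
  have hs3 : (√3 : ℝ) ^ 2 = 3 := Real.sq_sqrt (by norm_num)
  let y₁ : UnitSphere d := ⟨T (1 / 2) (√3 / 2) 0, hmem _ _ _ (by linear_combination hs3 / 4)⟩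
  have h11 : dist x₁ y₁ = 1 := by
    rw [hdist, show ((1 : ℝ) - 1 / 2) ^ 2 + (0 - √3 / 2) ^ 2 + ((0 : ℝ) - 0) ^ 2 = 1 by
      linear_combination hs3 / 4, Real.sqrt_one]
  -- Squared distances grow by 6/5 until they reach 1, where monotonicity takes over.
  have hiter : ∀ n : ℕ, ∀ x y : UnitSphere d, 1 ≤ (6 / 5 : ℝ) ^ n * dist x y ^ 2 →
      supportCorrelation f x y ≤ supportCorrelation f x₁ y₁ := by
    intro n
    induction n with
    | zero =>
      intro x y h
      refine supportCorrelation_anti hd hf hrect ?_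
      rw [h11]
      rw [pow_zero, one_mul] at h
      nlinarith [dist_nonneg (x := x) (y := y)]
    | succ n ih =>
      intro x y h
      by_cases h1 : dist x y ≤ 1
      · obtain ⟨x', y', hd', hle⟩ := exists_supportCorrelation_le hd hf hrect h1
        refine hle.trans (ih x' y' (h.trans ?_))
        rw [pow_succ, mul_assoc]
        gcongr
      · refine supportCorrelation_anti hd hf hrect ?_
        rw [h11]
        exact (not_le.1 h1).le
  have hle : ∀ x y : UnitSphere d, x ≠ y →
      supportCorrelation f x y ≤ supportCorrelation f x₁ y₁ := by
    intro x y hxy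
    have hpos : 0 < dist x y ^ 2 := by have := dist_pos.2 hxy; positivity
    obtain ⟨n, hn⟩ := pow_unbounded_of_one_lt (1 / dist x y ^ 2) (show (1 : ℝ) < 6 / 5 by norm_num)
    refine hiter n x y ?_
    rw [div_lt_iff₀ hpos] at hn
    exact hn.le
  -- Let the second point tend to x: where f(gx) ≠ 0, a subsequence is eventually nonzero too, so
  -- the measure of the support is bounded by correlations at positive distance.
  have hself : ∀ x : UnitSphere d, rotationMeasure d {g | f (rotate g x) ≠ 0} ≤
      supportCorrelation f x₁ y₁ := by
    intro x
    obtain ⟨k, rfl⟩ := exists_rotate_eq_left x₁ x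
    let w : ℝ → UnitSphere d := fun t => ⟨T (Real.cos t) (Real.sin t) 0, hmem _ _ _ (by simp)⟩
    have hw0 : w 0 = x₁ := Subtype.ext (by simp [w, x₁])
    have hwd : ∀ t, dist (w t) x₁ = √((Real.cos t - 1) ^ 2 + Real.sin t ^ 2) := by
      intro t
      rw [hdist]
      congr 1
      ring
    have hwlim : Tendsto (fun n : ℕ => w (1 / ((n : ℝ) + 1))) atTop (𝓝 x₁) := by
      rw [tendsto_iff_dist_tendsto_zero]
      simp only [hwd]
      have h1 : Continuous fun t : ℝ => √((Real.cos t - 1) ^ 2 + Real.sin t ^ 2) := by fun_prop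
      have h2 := (h1.tendsto 0).comp (tendsto_one_div_add_atTop_nhds_zero_nat (𝕜 := ℝ))
      simpa [Function.comp_def] using h2
    have hwne : ∀ n : ℕ, x₁ ≠ w (1 / ((n : ℝ) + 1)) := by
      intro n h
      have h1 := hwd (1 / ((n : ℝ) + 1))
      rw [← h, dist_self] at h1
      have h2 := (Real.sqrt_eq_zero (by positivity)).1 h1.symm
      have h3 : 0 < Real.sin (1 / ((n : ℝ) + 1)) := by
        refine Real.sin_pos_of_pos_of_lt_pi (by positivity) ?_
        have : 1 / ((n : ℝ) + 1) ≤ 1 := by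
          rw [div_le_one (by positivity)]
          linarith [(Nat.cast_nonneg n : (0 : ℝ) ≤ n)]
        linarith [Real.pi_gt_three]
      nlinarith [sq_nonneg (Real.cos (1 / ((n : ℝ) + 1)) - 1)]
    have hklim : Tendsto (fun n : ℕ => rotate k (w (1 / ((n : ℝ) + 1)))) atTop (𝓝 (rotate k x₁)) :=
      ((continuous_rotate.comp (Continuous.prodMk_right k)).tendsto x₁).comp hwlim
    obtain ⟨φ, hφ, hφ2⟩ := exists_strictMono_ae_tendsto_rotate hf hklim
    let D : ℕ → Set (RotationGroup d) := fun n => {g | f (rotate g (rotate k x₁)) ≠ 0 ∧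
      f (rotate g (rotate k (w (1 / ((φ n : ℝ) + 1))))) ≠ 0}
    let C : ℕ → Set (RotationGroup d) := fun N => ⋂ n ≥ N, D n
    have hC : Monotone C := fun N M hNM => biInter_subset_biInter_left fun n hn => le_trans hNM hn
    have hsub : rotationMeasure d {g | f (rotate g (rotate k x₁)) ≠ 0} ≤
        rotationMeasure d (⋃ N, C N) := by
      refine measure_mono_ae ?_
      filter_upwards [hφ2] with g hg hgx
      obtain ⟨N, hN⟩ := eventually_atTop.1 (hg.eventually_ne hgx)
      exact mem_iUnion.2 ⟨N, mem_iInter₂.2 fun n hn => ⟨hgx, hN n hn⟩⟩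
    refine hsub.trans ?_
    rw [hC.measure_iUnion]
    refine iSup_le fun N => ?_
    refine (measure_mono (biInter_subset_of_mem (show N ≥ N from le_rfl))).trans ?_
    refine hle (rotate k x₁) (rotate k (w (1 / ((φ N : ℝ) + 1)))) fun h => hwne (φ N) ?_
    refine Subtype.ext ((Unitary.linearIsometryEquiv k).injective ?_)
    exact congrArg Subtype.val h
  -- At distance at most 1 the correlation thus equals the measure of {f(gx) ≠ 0}; by finiteness
  -- this is an almost everywhere inclusion.
  have himp : ∀ x y : UnitSphere d, dist x y ≤ 1 → ∀ᵐ g ∂rotationMeasure d,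
      f (rotate g x) ≠ 0 → f (rotate g y) ≠ 0 := by
    intro x y hxy
    have h1 : rotationMeasure d {g | f (rotate g x) ≠ 0} ≤
        rotationMeasure d {g | f (rotate g x) ≠ 0 ∧ f (rotate g y) ≠ 0} :=
      (hself x).trans (supportCorrelation_anti hd hf hrect (by rw [h11]; exact hxy))
    have h2 := ae_eq_of_subset_of_measure_ge (fun g hg => hg.1) h1
      ((measurableSet_rotate_ne_zero hf x).inter
        (measurableSet_rotate_ne_zero hf y)).nullMeasurableSet (measure_ne_top _ _)
    filter_upwards [h2] with g hg hgx
    exact (hg.mpr hgx).2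
  have hmeasf : Measurable fun p : RotationGroup d × UnitSphere d => f (rotate p.1 p.2) :=
    hf.comp continuous_rotate.measurable
  have hall : ∀ᵐ g ∂rotationMeasure d, ∀ᵐ q ∂((surfaceMeasure d).prod (surfaceMeasure d)),
      dist q.2 q.1 ≤ 1 → (f (rotate g q.2) ≠ 0 ↔ f (rotate g q.1) ≠ 0) := by
    refine (Measure.ae_ae_comm ?_).1 (Eventually.of_forall fun q => ?_)
    · have m1 : Measurable fun p : (UnitSphere d × UnitSphere d) × RotationGroup d =>
        f (rotate p.2 p.1.1) := hmeasf.comp (f := fun p : (UnitSphere d × UnitSphere d) ×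
          RotationGroup d => (p.2, p.1.1)) (by fun_prop)
      have m2 : Measurable fun p : (UnitSphere d × UnitSphere d) × RotationGroup d =>
        f (rotate p.2 p.1.2) := hmeasf.comp (f := fun p : (UnitSphere d × UnitSphere d) ×
          RotationGroup d => (p.2, p.1.2)) (by fun_prop)
      refine MeasurableSet.imp ?_ (MeasurableSet.iff (m2 (measurableSet_singleton 0).compl)
        (m1 (measurableSet_singleton 0).compl))
      exact measurableSet_le (by fun_prop) measurable_const
    · by_cases hq : dist q.2 q.1 ≤ 1
      · filter_upwards [himp _ _ hq, himp q.1 q.2 (by rwa [dist_comm])] with g h1 h2 _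
        exact ⟨h1, h2⟩
      · exact Eventually.of_forall fun g h => absurd h hq
  obtain ⟨g, hg⟩ := hall.exists
  have := preconnectedSpace_unitSphere (d := d) (by omega)
  have := nonempty_unitSphere (d := d) (by omega)
  obtain ⟨c, hc⟩ := ae_eq_const_of_ae_dist_lt (surfaceMeasure d)
    (fun x => f (rotate g x) ≠ 0) one_pos (by
      filter_upwards [Measure.ae_ae_of_ae_prod hg] with x hx
      filter_upwards [hx] with y hy hlt
      exact propext (hy hlt.le))
  by_cases hcT : c
  · refine ae_of_ae_rotate g ?_
    filter_upwards [hc] with x hx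
    exact hx.mpr hcT
  · refine absurd (ae_of_ae_rotate g ?_) hf0
    filter_upwards [hc] with x hx
    by_contra h
    exact hcT (hx.mp h)

end Correlation

/-! ### Chords of the sphere and their multiplicative increments -/

/-- Every vector of norm at most two is a chord of the unit sphere, in a measurable way. -/
theorem exists_measurable_chord {d : ℕ} (hd : 2 ≤ d) :
    ∃ p q : EuclideanSpace ℝ (Fin d) → UnitSphere d, Measurable p ∧ Measurable q ∧
      ∀ u, ‖u‖ ≤ 2 → (p u : EuclideanSpace ℝ (Fin d)) - q u = u := by
  let i : Fin d := ⟨0, by omega⟩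
  let j : Fin d := ⟨1, by omega⟩
  have hij : i ≠ j := by simp [i, j]
  -- `J u` is a quarter turn of the projection of u to two coordinates, hence orthogonal to u; if it
  -- vanishes, so do these coordinates and the basis vector is orthogonal to u. The chord ends are
  -- ±u/2 + √(1 - |u|²/4) n(u).
  let J : EuclideanSpace ℝ (Fin d) → EuclideanSpace ℝ (Fin d) := fun u =>
    u j • EuclideanSpace.single i 1 - u i • EuclideanSpace.single j 1
  have hJm : Measurable J := by fun_prop
  have hJu : ∀ u, inner ℝ u (J u) = 0 := by
    intro u
    simp only [J, inner_sub_right, real_inner_smul_right, EuclideanSpace.inner_single_right]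
    simp
    ring
  let n : EuclideanSpace ℝ (Fin d) → EuclideanSpace ℝ (Fin d) := fun u =>
    if J u = 0 then EuclideanSpace.single i 1 else ‖J u‖⁻¹ • J u
  have hnm : Measurable n := Measurable.ite (hJm (measurableSet_singleton 0)) measurable_const
    (by fun_prop)
  have hn1 : ∀ u, ‖n u‖ = 1 := by
    intro u
    simp only [n]
    split_ifs with h
    · simp
    · rw [norm_smul, norm_inv, norm_norm, inv_mul_cancel₀ (norm_ne_zero_iff.2 h)]
  have hnu : ∀ u, inner ℝ u (n u) = 0 := by
    intro u
    simp only [n]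
    split_ifs with h
    · have := congrArg (fun w : EuclideanSpace ℝ (Fin d) => w j) h
      simp [J, hij.symm] at this
      simp [EuclideanSpace.inner_single_right, this]
    · rw [real_inner_smul_right, hJu, mul_zero]
  let w : ℝ → EuclideanSpace ℝ (Fin d) → EuclideanSpace ℝ (Fin d) := fun ε u =>
    if ‖u‖ ≤ 2 then (ε / 2) • u + √(1 - ‖u‖ ^ 2 / 4) • n u else EuclideanSpace.single i 1
  have hwm : ∀ ε, Measurable (w ε) := fun ε =>
    Measurable.ite (measurableSet_le (by fun_prop) measurable_const) (by fun_prop) measurable_const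
  have hw : ∀ ε : ℝ, ε ^ 2 = 1 → ∀ u, w ε u ∈ sphere (0 : EuclideanSpace ℝ (Fin d)) 1 := by
    intro ε hε u
    rw [mem_sphere_zero_iff_norm]
    simp only [w]
    split_ifs with h
    · have h1 : ‖(ε / 2) • u + √(1 - ‖u‖ ^ 2 / 4) • n u‖ ^ 2 = 1 := by
        rw [norm_add_sq_real, norm_smul, norm_smul, hn1, real_inner_smul_left,
          real_inner_smul_right, hnu, mul_one, mul_pow, Real.norm_eq_abs, Real.norm_eq_abs, sq_abs,
          sq_abs, Real.sq_sqrt (by nlinarith [norm_nonneg u])]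
        linear_combination ‖u‖ ^ 2 / 4 * hε
      nlinarith [norm_nonneg ((ε / 2) • u + √(1 - ‖u‖ ^ 2 / 4) • n u)]
    · simp
  refine ⟨fun u => ⟨w 1 u, hw 1 (by norm_num) u⟩, fun u => ⟨w (-1) u, hw (-1) (by norm_num) u⟩,
    (hwm 1).subtype_mk, (hwm (-1)).subtype_mk, fun u hu => ?_⟩
  simp only [w, if_pos hu]
  rw [add_sub_add_right_eq_sub, ← sub_smul]
  norm_num

section ChordCharacter

variable {d : ℕ} {Γ : Type*} [CommGroup Γ] {A : UnitSphere d → Γ}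
  {φ : EuclideanSpace ℝ (Fin d) → Γ}

/-- The points ±u/2 ± v/2 + r n are the vertices of an inscribed rectangle with sides u, v. Two
sides and the diagonal have the same total increment. Dimension three supplies the normal n. -/
theorem chord_mul_of_inner_eq_zero (hd : 3 ≤ d)
    (h : ∀ x x' : UnitSphere d,
      A x = φ ((x : EuclideanSpace ℝ (Fin d)) - (x' : EuclideanSpace ℝ (Fin d))) * A x')
    {u v : EuclideanSpace ℝ (Fin d)} (huv : inner ℝ u v = 0) (hle : ‖u‖ ^ 2 + ‖v‖ ^ 2 ≤ 4) :
    φ (u + v) = φ u * φ v := by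
  obtain ⟨n, hn1, hnu, hnv⟩ := exists_norm_eq_one_inner_eq_zero hd u v
  set r := √(1 - (‖u‖ ^ 2 + ‖v‖ ^ 2) / 4) with hr
  have hr2 : r ^ 2 = 1 - (‖u‖ ^ 2 + ‖v‖ ^ 2) / 4 := Real.sq_sqrt (by linarith)
  have hmem : ∀ a b : ℝ, a ^ 2 = 1 → b ^ 2 = 1 →
      (a / 2) • u + (b / 2) • v + r • n ∈ sphere (0 : EuclideanSpace ℝ (Fin d)) 1 := by
    intro a b ha hb
    rw [mem_sphere_zero_iff_norm]
    have h1 : ‖(a / 2) • u + (b / 2) • v + r • n‖ ^ 2 = 1 := by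
      rw [norm_add_sq_real, norm_add_sq_real, inner_add_left]
      simp only [real_inner_smul_left, real_inner_smul_right, huv, hnu, hnv, norm_smul, hn1,
        mul_pow, Real.norm_eq_abs, sq_abs]
      rw [hr2]
      linear_combination ‖u‖ ^ 2 / 4 * ha + ‖v‖ ^ 2 / 4 * hb
    nlinarith [norm_nonneg ((a / 2) • u + (b / 2) • v + r • n)]
  let x : UnitSphere d := ⟨_, hmem 1 1 (by norm_num) (by norm_num)⟩
  let x' : UnitSphere d := ⟨_, hmem (-1) 1 (by norm_num) (by norm_num)⟩
  let x'' : UnitSphere d := ⟨_, hmem (-1) (-1) (by norm_num) (by norm_num)⟩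
  have e1 : (x : EuclideanSpace ℝ (Fin d)) - (x' : EuclideanSpace ℝ (Fin d)) = u := by
    simp only [x, x']
    module
  have e2 : (x' : EuclideanSpace ℝ (Fin d)) - (x'' : EuclideanSpace ℝ (Fin d)) = v := by
    simp only [x'', x']
    module
  have e3 : (x : EuclideanSpace ℝ (Fin d)) - (x'' : EuclideanSpace ℝ (Fin d)) = u + v := by
    simp only [x, x'']
    module
  have h1 := h x x'
  have h2 := h x' x''
  have h3 := h x x''
  rw [e1] at h1
  rw [e2] at h2
  rw [e3, h1, h2, ← mul_assoc] at h3
  exact (mul_right_cancel h3).symm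

theorem chord_neg (hd : 3 ≤ d)
    (h : ∀ x x' : UnitSphere d,
      A x = φ ((x : EuclideanSpace ℝ (Fin d)) - (x' : EuclideanSpace ℝ (Fin d))) * A x')
    {u : EuclideanSpace ℝ (Fin d)} (hu : ‖u‖ ≤ 2) : φ (-u) = (φ u)⁻¹ := by
  obtain ⟨p, q, -, -, hpq⟩ := exists_measurable_chord (d := d) (by omega)
  have h1 := h (p u) (q u)
  have h2 := h (q u) (p u)
  rw [hpq u hu] at h1
  rw [← neg_sub, hpq u hu, h1, ← mul_assoc] at h2
  exact eq_inv_of_mul_eq_one_left (right_eq_mul.1 h2)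

/-- The altitude of a right triangle: for w orthogonal to u with |w|² = ab|u|², the legs a u + w and
b u - w are orthogonal and add up to (a + b) u. Orthogonal multiplicativity applies three times, and
φ(w)φ(-w) = 1. -/
theorem chord_add_smul_of_nonneg (hd : 3 ≤ d)
    (h : ∀ x x' : UnitSphere d,
      A x = φ ((x : EuclideanSpace ℝ (Fin d)) - (x' : EuclideanSpace ℝ (Fin d))) * A x')
    {u : EuclideanSpace ℝ (Fin d)} {a b : ℝ} (ha : 0 ≤ a) (hb : 0 ≤ b) (hab : (a + b) * ‖u‖ ≤ 2) :
    φ ((a + b) • u) = φ (a • u) * φ (b • u) := by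
  obtain ⟨n, hn1, hnu, -⟩ := exists_norm_eq_one_inner_eq_zero hd u u
  set w := (√(a * b) * ‖u‖) • n with hw
  have hsq : √(a * b) ^ 2 = a * b := Real.sq_sqrt (mul_nonneg ha hb)
  have hw2 : ‖w‖ ^ 2 = a * b * ‖u‖ ^ 2 := by
    rw [hw, norm_smul, hn1, mul_one, Real.norm_eq_abs, sq_abs, mul_pow, hsq]
  have huw : inner ℝ u w = 0 := by rw [hw, real_inner_smul_right, hnu, mul_zero]
  have hu0 := norm_nonneg u
  have hab0 : 0 ≤ a * b := mul_nonneg ha hb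
  have hsum : ((a + b) * ‖u‖) ^ 2 ≤ 4 := by
    have : 0 ≤ (a + b) * ‖u‖ := by positivity
    nlinarith
  have hna : ‖a • u‖ ^ 2 = a ^ 2 * ‖u‖ ^ 2 := by
    rw [norm_smul, mul_pow, Real.norm_eq_abs, sq_abs]
  have hnb : ‖b • u‖ ^ 2 = b ^ 2 * ‖u‖ ^ 2 := by
    rw [norm_smul, mul_pow, Real.norm_eq_abs, sq_abs]
  have hc1 : 0 ≤ a * b * ‖u‖ ^ 2 := by positivity
  have hc2 : 0 ≤ a ^ 2 * ‖u‖ ^ 2 := by positivity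
  have hc3 : 0 ≤ b ^ 2 * ‖u‖ ^ 2 := by positivity
  have iau : inner ℝ (a • u) w = 0 := by rw [real_inner_smul_left, huw, mul_zero]
  have ibu : inner ℝ (b • u) (-w) = 0 := by
    rw [real_inner_smul_left, inner_neg_right, huw, neg_zero, mul_zero]
  have h1 : φ (a • u + w) = φ (a • u) * φ w :=
    chord_mul_of_inner_eq_zero hd h iau (by rw [hna, hw2]; nlinarith)
  have h2 : φ (b • u + -w) = φ (b • u) * φ (-w) :=
    chord_mul_of_inner_eq_zero hd h ibu (by rw [hnb, norm_neg, hw2]; nlinarith)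
  have h3 : φ ((a • u + w) + (b • u + -w)) = φ (a • u + w) * φ (b • u + -w) := by
    refine chord_mul_of_inner_eq_zero hd h ?_ ?_
    · have iab : inner ℝ (a • u) (b • u) = a * b * ‖u‖ ^ 2 := by
        rw [real_inner_smul_left, real_inner_smul_right, real_inner_self_eq_norm_sq]
        ring
      have ibw : inner ℝ w (b • u) = 0 := by
        rw [real_inner_comm, real_inner_smul_left, huw, mul_zero]
      rw [inner_add_left, inner_add_right, inner_add_right, inner_neg_right, inner_neg_right, iau,
        iab, ibw, real_inner_self_eq_norm_sq, hw2]
      ring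
    · rw [norm_add_sq_real, norm_add_sq_real, iau, ibu, hna, hnb, norm_neg, hw2]
      nlinarith
  have hw4 : ‖w‖ ≤ 2 := by
    have : ‖w‖ ^ 2 ≤ 4 := by rw [hw2]; nlinarith
    nlinarith [norm_nonneg w]
  rw [show (a • u + w) + (b • u + -w) = (a + b) • u by module, h1, h2,
    chord_neg hd h hw4] at h3
  rw [h3, mul_mul_mul_comm, mul_inv_cancel, mul_one]

theorem chord_one_add_smul (hd : 3 ≤ d)
    (h : ∀ x x' : UnitSphere d,
      A x = φ ((x : EuclideanSpace ℝ (Fin d)) - (x' : EuclideanSpace ℝ (Fin d))) * A x')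
    {u : EuclideanSpace ℝ (Fin d)} {b : ℝ} (hu : ‖u‖ ≤ 1) (hb : |b| * ‖u‖ ≤ 1) :
    φ ((1 + b) • u) = φ u * φ (b • u) := by
  have hu0 := norm_nonneg u
  rcases le_or_gt 0 b with hb0 | hb0
  · rw [abs_of_nonneg hb0] at hb
    have := chord_add_smul_of_nonneg hd h (u := u) zero_le_one hb0 (by nlinarith)
    rwa [one_smul] at this
  · rw [abs_of_neg hb0] at hb
    have hbn : ‖(-b) • u‖ ≤ 2 := by
      rw [norm_smul, Real.norm_eq_abs, abs_of_pos (by linarith)]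
      linarith
    have hneg := chord_neg hd h hbn
    rw [← neg_smul, neg_neg] at hneg
    rcases le_or_gt 0 (1 + b) with h1 | h1
    · have h2 := chord_add_smul_of_nonneg hd h (u := u) h1 (neg_nonneg.2 hb0.le) (by nlinarith)
      rw [add_neg_cancel_right, one_smul] at h2
      rw [h2, hneg, mul_inv_cancel_right]
    · have h2 := chord_add_smul_of_nonneg hd h (u := u) zero_le_one
        (neg_nonneg.2 h1.le) (by nlinarith)
      have h3 : ‖(1 + b) • u‖ ≤ 2 := by
        rw [norm_smul, Real.norm_eq_abs, abs_of_neg h1]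
        nlinarith
      rw [one_smul, neg_smul, chord_neg hd h h3, show 1 + -(1 + b) = -b by ring] at h2
      rw [hneg, h2, mul_inv, inv_inv, mul_inv_cancel_left]

/-- The multiplicative increment along chords of the sphere is multiplicative near the origin. -/
theorem chord_add (hd : 3 ≤ d)
    (h : ∀ x x' : UnitSphere d,
      A x = φ ((x : EuclideanSpace ℝ (Fin d)) - (x' : EuclideanSpace ℝ (Fin d))) * A x')
    {u v : EuclideanSpace ℝ (Fin d)} (hu : ‖u‖ ≤ 1 / 2) (hv : ‖v‖ ≤ 1 / 2) :
    φ (u + v) = φ u * φ v := by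
  have hu0 := norm_nonneg u
  have hv0 := norm_nonneg v
  rcases eq_or_ne u 0 with rfl | hne
  · refine chord_mul_of_inner_eq_zero hd h (by simp) ?_
    rw [norm_zero]
    nlinarith
  have hpos : 0 < ‖u‖ := norm_pos_iff.2 hne
  set b := inner ℝ u v / ‖u‖ ^ 2 with hb
  set z := v - b • u with hz
  have hbz : v = b • u + z := by rw [hz]; abel
  have huz : inner ℝ u z = 0 := by
    rw [hz, inner_sub_right, real_inner_smul_right, real_inner_self_eq_norm_sq, hb]
    field_simp
    ring
  have hpyth : ‖v‖ ^ 2 = (|b| * ‖u‖) ^ 2 + ‖z‖ ^ 2 := by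
    conv_lhs => rw [hbz]
    rw [norm_add_sq_real, real_inner_smul_left, huz, norm_smul, Real.norm_eq_abs]
    ring
  have hv2 : ‖v‖ ^ 2 ≤ 1 / 4 := by nlinarith
  have hbu : |b| * ‖u‖ ≤ 1 / 2 := by
    have : 0 ≤ |b| * ‖u‖ := by positivity
    nlinarith [sq_nonneg ‖z‖]
  have hz2 : ‖z‖ ^ 2 ≤ 1 / 4 := by nlinarith [sq_nonneg (|b| * ‖u‖)]
  have hn1 : ‖b • u‖ ^ 2 ≤ 1 := by
    rw [norm_smul, Real.norm_eq_abs]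
    nlinarith [sq_nonneg ‖z‖]
  have hn2 : ‖(1 + b) • u‖ ≤ 1 := by
    rw [add_smul, one_smul]
    refine (norm_add_le _ _).trans ?_
    rw [norm_smul, Real.norm_eq_abs]
    linarith
  have e1 : φ ((1 + b) • u + z) = φ ((1 + b) • u) * φ z :=
    chord_mul_of_inner_eq_zero hd h (by rw [real_inner_smul_left, huz, mul_zero])
      (by nlinarith [norm_nonneg ((1 + b) • u)])
  have e2 : φ (b • u + z) = φ (b • u) * φ z :=
    chord_mul_of_inner_eq_zero hd h (by rw [real_inner_smul_left, huz, mul_zero])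
      (by linarith)
  rw [← hbz] at e2
  rw [show (1 + b) • u + z = u + v by rw [hz]; module,
    chord_one_add_smul hd h (by linarith) (by linarith)] at e1
  rw [e1, e2, mul_assoc]

end ChordCharacter

/-! ### Conclusion in dimension at least three -/

theorem ae_forall_rotate_of_forall_ae {d : ℕ} {Y : Type*} [MeasurableSpace Y] {ν : Measure Y}
    [SFinite ν] {p : Y → RotationGroup d → Prop}
    (hm : MeasurableSet {q : Y × RotationGroup d | p q.1 q.2})
    (h : ∀ y, ∀ᵐ g ∂rotationMeasure d, p y g) : ∀ᵐ g ∂rotationMeasure d, ∀ᵐ y ∂ν, p y g :=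
  (Measure.ae_ae_comm hm).1 (Eventually.of_forall h)

theorem measurable_comp_rotate {d : ℕ} {f : UnitSphere d → ℂ} (hf : Measurable f) {Y : Type*}
    [MeasurableSpace Y] {a : Y → RotationGroup d} {b : Y → UnitSphere d} (ha : Measurable a)
    (hb : Measurable b) : Measurable fun y => f (rotate (a y) (b y)) :=
  hf.comp (continuous_rotate.measurable.comp (ha.prodMk hb))

/-- A nowhere vanishing function on the sphere whose product at two points depends, for almost all
rotations, only on the sum of the points is an exponential. -/
theorem exists_ae_eq_exp_of_rotate_mul_eq {d : ℕ} (hd : 3 ≤ d) {f : UnitSphere d → ℂ} (hf : Measurable f)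
    (hf0 : ∀ x, f x ≠ 0)
    (hrect : ∀ x y x' y' : UnitSphere d,
      (x : EuclideanSpace ℝ (Fin d)) + y = x' + y' → ∀ᵐ g ∂rotationMeasure d,
        f (rotate g x) * f (rotate g y) = f (rotate g x') * f (rotate g y')) :
    ∃ (l : EuclideanSpace ℝ (Fin d) →L[ℝ] ℂ) (c : ℂ), c ≠ 0 ∧
      ∀ᵐ z : UnitSphere d ∂surfaceMeasure d, f z = c * Complex.exp (l z) := by
  obtain ⟨p, q, hp, hq, hpq⟩ := exists_measurable_chord (d := d) (by omega)
  let a : UnitSphere d → RotationGroup d → ℂˣ := fun x g => Units.mk0 (f (rotate g x)) (hf0 _)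
  -- In the group of germs of ℂˣ-valued functions of g modulo null sets, the relations hold exactly
  -- for every point, so the chord lemmas apply.
  let A : UnitSphere d → Germ (ae (rotationMeasure d)) ℂˣ := fun x => (a x : Germ _ _)
  let φ : EuclideanSpace ℝ (Fin d) → Germ (ae (rotationMeasure d)) ℂˣ :=
    fun v => A (p v) / A (q v)
  let ψ : RotationGroup d → EuclideanSpace ℝ (Fin d) → ℂ :=
    fun g v => f (rotate g (p v)) / f (rotate g (q v))
  have hφ : ∀ v, φ v = ((fun g => a (p v) g / a (q v) g : RotationGroup d → ℂˣ) : Germ _ _) :=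
    fun v => rfl
  have hψ : ∀ v g, ψ g v = ((a (p v) g / a (q v) g : ℂˣ) : ℂ) := fun v g => by
    rw [Units.val_div_eq_div_val]
    rfl
  have hA : ∀ x x' : UnitSphere d,
      A x = φ ((x : EuclideanSpace ℝ (Fin d)) - (x' : EuclideanSpace ℝ (Fin d))) * A x' := by
    intro x x'
    set v := (x : EuclideanSpace ℝ (Fin d)) - (x' : EuclideanSpace ℝ (Fin d)) with hv
    have hv2 : ‖v‖ ≤ 2 := by
      refine (norm_sub_le _ _).trans ?_
      rw [norm_eq_of_mem_sphere, norm_eq_of_mem_sphere]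
      norm_num
    have h1 := hrect x (q v) (p v) x' (by
      have := hpq v hv2
      rw [hv, sub_eq_sub_iff_add_eq_add] at this
      rw [← this])
    simp only [φ]
    rw [div_mul_eq_mul_div, eq_div_iff_mul_eq']
    refine Germ.coe_eq.2 ?_
    filter_upwards [h1] with g hg
    refine Units.ext ?_
    simpa [a, mul_comm] using hg
  have hadd : ∀ u v : EuclideanSpace ℝ (Fin d), ‖u‖ ≤ 1 / 2 → ‖v‖ ≤ 1 / 2 →
      ∀ᵐ g ∂rotationMeasure d, ψ g (u + v) = ψ g u * ψ g v := by
    intro u v hu hv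
    have h1 := chord_add hd hA hu hv
    rw [hφ, hφ, hφ] at h1
    filter_upwards [Germ.coe_eq.1 h1] with g hg
    rw [hψ, hψ, hψ, hg]
    simp
  have htr : ∀ (z z' : UnitSphere d) (s : EuclideanSpace ℝ (Fin d)), dist z z' ≤ 1 / 2 →
      ‖s‖ ≤ 1 / 2 → ∀ᵐ g ∂rotationMeasure d,
        ψ g (s + ((z : EuclideanSpace ℝ (Fin d)) - z')) * f (rotate g z') =
          ψ g s * f (rotate g z) := by
    intro z z' s hz hs
    rw [Subtype.dist_eq, dist_eq_norm] at hz
    have h1 : φ (s + ((z : EuclideanSpace ℝ (Fin d)) - z')) * A z' = φ s * A z := by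
      rw [chord_add hd hA hs hz, hA z z', mul_assoc]
    rw [hφ, hφ] at h1
    filter_upwards [Germ.coe_eq.1 h1] with g hg
    have := congrArg Units.val hg
    rw [hψ, hψ]
    simpa [a] using this
  have hψm : ∀ {Y : Type _} [MeasurableSpace Y] {b : Y → RotationGroup d}
      {c : Y → EuclideanSpace ℝ (Fin d)}, Measurable b → Measurable c →
      Measurable fun y => ψ (b y) (c y) := fun hb hc =>
    (measurable_comp_rotate hf hb (hp.comp hc)).div (measurable_comp_rotate hf hb (hq.comp hc))
  have h1 : ∀ᵐ g ∂rotationMeasure d, ∀ᵐ w : EuclideanSpace ℝ (Fin d) × EuclideanSpace ℝ (Fin d),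
      ‖w.1‖ ≤ 1 / 2 ∧ ‖w.2‖ ≤ 1 / 2 → ψ g (w.1 + w.2) = ψ g w.1 * ψ g w.2 := by
    refine ae_forall_rotate_of_forall_ae ?_ fun w => ?_
    · refine MeasurableSet.imp ?_ (measurableSet_eq_fun ?_ ?_)
      · exact (measurableSet_le (measurable_fst.comp measurable_fst).norm measurable_const).inter
          (measurableSet_le (measurable_snd.comp measurable_fst).norm measurable_const)
      · exact hψm measurable_snd (by fun_prop)
      · exact (hψm measurable_snd (by fun_prop)).mul (hψm measurable_snd (by fun_prop))
    · by_cases hw : ‖w.1‖ ≤ 1 / 2 ∧ ‖w.2‖ ≤ 1 / 2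
      · filter_upwards [hadd w.1 w.2 hw.1 hw.2] with g hg _ using hg
      · exact Eventually.of_forall fun g h => absurd h hw
  have h2 : ∀ᵐ g ∂rotationMeasure d, ∀ᵐ w : UnitSphere d × UnitSphere d × EuclideanSpace ℝ (Fin d)
      ∂((surfaceMeasure d).prod ((surfaceMeasure d).prod volume)),
      dist w.2.1 w.1 ≤ 1 / 2 ∧ ‖w.2.2‖ ≤ 1 / 2 →
        ψ g (w.2.2 + ((w.2.1 : EuclideanSpace ℝ (Fin d)) - w.1)) * f (rotate g w.1) =
          ψ g w.2.2 * f (rotate g w.2.1) := by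
    have : SFinite ((surfaceMeasure d).prod (volume : Measure (EuclideanSpace ℝ (Fin d)))) :=
      inferInstance
    have : SFinite ((surfaceMeasure d).prod ((surfaceMeasure d).prod
      (volume : Measure (EuclideanSpace ℝ (Fin d))))) := Measure.prod.instSFinite
    refine ae_forall_rotate_of_forall_ae ?_ fun w => ?_
    · refine MeasurableSet.imp ?_ (measurableSet_eq_fun ?_ ?_)
      · exact (measurableSet_le (measurable_fst.snd.fst.dist measurable_fst.fst)
          measurable_const).inter (measurableSet_le measurable_fst.snd.snd.norm measurable_const)
      · exact (hψm measurable_snd (by fun_prop)).mul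
          (measurable_comp_rotate hf measurable_snd (by fun_prop))
      · exact (hψm measurable_snd (by fun_prop)).mul
          (measurable_comp_rotate hf measurable_snd (by fun_prop))
    · by_cases hw : dist w.2.1 w.1 ≤ 1 / 2 ∧ ‖w.2.2‖ ≤ 1 / 2
      · filter_upwards [htr w.2.1 w.1 w.2.2 hw.1 hw.2] with g hg _ using hg
      · exact Eventually.of_forall fun g h => absurd h hw
  -- A single g now serves almost all configurations; it is undone at the end by composing with g⁻¹.
  obtain ⟨g, hg1, hg2⟩ := (h1.and h2).exists
  have hne : ∀ v, ψ g v ≠ 0 := fun v => div_ne_zero (hf0 _) (hf0 _)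
  obtain ⟨l, c, hc, hl⟩ := exists_ae_eq_exp_of_translation (d := d) (by omega)
    (F := fun z => f (rotate g z)) (P := ψ g) (χ := ψ g) (hψm measurable_const measurable_id)
    (hψm measurable_const measurable_id) (r := 1 / 2) (by norm_num)
    (by
      filter_upwards [hg1] with w hw h1 h2
      exact hw ⟨(mem_ball_zero_iff.1 h1).le, (mem_ball_zero_iff.1 h2).le⟩)
    (Eventually.of_forall fun s _ => hne s) (Eventually.of_forall fun s _ => hne s)
    (Eventually.of_forall fun z => hf0 _)
    (by
      filter_upwards [Measure.ae_ae_of_ae_prod hg2] with z' hz'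
      filter_upwards [Measure.ae_ae_of_ae_prod hz'] with z hz hzz
      filter_upwards [hz] with s hs hss
      exact hs ⟨hzz.le, (mem_ball_zero_iff.1 hss).le⟩)
  refine ⟨l.comp ((g⁻¹ : RotationGroup d) :
    EuclideanSpace ℝ (Fin d) →L[ℝ] EuclideanSpace ℝ (Fin d)), c, hc, ae_of_ae_rotate g ?_⟩
  filter_upwards [hl] with z hz
  rw [hz, ContinuousLinearMap.comp_apply, ← coe_rotate, ← rotate_mul, inv_mul_cancel]
  rfl

/-- In dimension at least three, a measurable function on the sphere for which the tensor square is
a function of the sum of the variables is zero or an exponential. -/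
theorem exists_ae_eq_exp_of_pair {d : ℕ} (hd : 3 ≤ d) {f : UnitSphere d → ℂ} (hf : Measurable f)
    {H : EuclideanSpace ℝ (Fin d) → ℂ}
    (hH : ∀ᵐ q ∂((surfaceMeasure d).prod (surfaceMeasure d)), f q.1 * f q.2 =
      H ((q.1 : EuclideanSpace ℝ (Fin d)) + (q.2 : EuclideanSpace ℝ (Fin d))))
    (hf0 : ¬ ∀ᵐ x ∂surfaceMeasure d, f x = 0) :
    ∃ (l : EuclideanSpace ℝ (Fin d) →L[ℝ] ℂ) (c : ℂ), c ≠ 0 ∧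
      ∀ᵐ z : UnitSphere d ∂surfaceMeasure d, f z = c * Complex.exp (l z) := by
  have hne := ae_ne_zero_of_rectangle hd hf (fun x y x' y' hadd => by
    filter_upwards [ae_rotate_mul_eq_of_add_eq hd hf hH hadd] with g hg h1 h2 h3
    rw [h3, zero_mul] at hg
    exact mul_ne_zero h1 h2 hg) hf0
  -- Changing f on a null set makes it ℂˣ-valued.
  let f₁ : UnitSphere d → ℂ := fun z => if f z = 0 then 1 else f z
  have hff : ∀ᵐ z ∂surfaceMeasure d, f z = f₁ z := by
    filter_upwards [hne] with z hz
    simp only [f₁, if_neg hz]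
  obtain ⟨l, c, hc, hl⟩ := exists_ae_eq_exp_of_rotate_mul_eq hd (f := f₁)
    (Measurable.ite (hf (measurableSet_singleton 0)) measurable_const hf)
    (fun x => by
      simp only [f₁]
      split_ifs with h
      · exact one_ne_zero
      · exact h)
    (fun x y x' y' hadd => by
      filter_upwards [ae_rotate_mul_eq_of_add_eq hd hf hH hadd, ae_rotate_of_ae hff x,
        ae_rotate_of_ae hff y, ae_rotate_of_ae hff x', ae_rotate_of_ae hff y'] with g h h1 h2 h3 h4
      rwa [← h1, ← h2, ← h3, ← h4])
  refine ⟨l, c, hc, ?_⟩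
  filter_upwards [hff, hl] with z h1 h2
  rw [h1, h2]

/-! ### Angles and sums of two points on the unit circle -/

/-- The identification of `ℝ × ℝ` with the Euclidean plane. -/
noncomputable def planeEquiv : ℝ × ℝ ≃ᵐ EuclideanSpace ℝ (Fin 2) :=
  MeasurableEquiv.finTwoArrow.symm.trans (MeasurableEquiv.toLp 2 (Fin 2 → ℝ))

theorem planeEquiv_apply (w : ℝ × ℝ) : planeEquiv w = !₂[w.1, w.2] := rfl

theorem measurePreserving_planeEquiv : MeasurePreserving planeEquiv :=
  ((volume_preserving_finTwoArrow ℝ).symm _).trans (PiLp.volume_preserving_toLp (Fin 2))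

/-- The point of the unit circle with angle `θ`. -/
noncomputable def circlePoint (θ : ℝ) : UnitSphere 2 :=
  ⟨planeEquiv (Real.cos θ, Real.sin θ), by
    rw [mem_sphere_zero_iff_norm, EuclideanSpace.norm_eq]
    simp [planeEquiv_apply]⟩

theorem coe_circlePoint (θ : ℝ) :
    (circlePoint θ : EuclideanSpace ℝ (Fin 2)) = planeEquiv (Real.cos θ, Real.sin θ) := rfl

theorem measurable_circlePoint : Measurable circlePoint :=
  (planeEquiv.measurable.comp
    (Real.measurable_cos.prodMk Real.measurable_sin)).subtype_mk

theorem planeEquiv_add (v w : ℝ × ℝ) : planeEquiv (v + w) = planeEquiv v + planeEquiv w := by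
  ext i
  fin_cases i <;> simp [planeEquiv_apply]

theorem exists_circlePoint_eq (x : UnitSphere 2) : ∃ θ ∈ Ioc (-Real.pi) Real.pi, circlePoint θ = x := by
  obtain ⟨w, hw⟩ := planeEquiv.surjective (x : EuclideanSpace ℝ (Fin 2))
  have hx := norm_eq_of_mem_sphere x
  rw [← hw, EuclideanSpace.norm_eq, Real.sqrt_eq_one] at hx
  simp only [planeEquiv_apply, Fin.sum_univ_two, Real.norm_eq_abs, sq_abs] at hx
  change w.1 ^ 2 + w.2 ^ 2 = 1 at hx
  have hz : ‖(⟨w.1, w.2⟩ : ℂ)‖ = 1 := by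
    rw [Complex.norm_def, Complex.normSq_mk, Real.sqrt_eq_one]
    linarith
  have hz0 : (⟨w.1, w.2⟩ : ℂ) ≠ 0 := by
    rw [← norm_ne_zero_iff, hz]
    exact one_ne_zero
  refine ⟨Complex.arg ⟨w.1, w.2⟩, Complex.arg_mem_Ioc _, Subtype.ext ?_⟩
  rw [coe_circlePoint, ← hw, Complex.cos_arg hz0, Complex.sin_arg, hz]
  simp

theorem smul_circlePoint_mem_smul_iff {s : Set (UnitSphere 2)} {r θ : ℝ} (hr : 0 < r) :
    planeEquiv (r * Real.cos θ, r * Real.sin θ) ∈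
      Ioo (0 : ℝ) 1 • ((↑) '' s : Set (EuclideanSpace ℝ (Fin 2))) ↔ r < 1 ∧ circlePoint θ ∈ s := by
  have h0 : planeEquiv (r * Real.cos θ, r * Real.sin θ) =
      r • (circlePoint θ : EuclideanSpace ℝ (Fin 2)) := by
    ext i
    fin_cases i <;> simp [planeEquiv_apply, coe_circlePoint]
  rw [h0, Set.mem_smul]
  constructor
  · rintro ⟨t, ht, _, ⟨y, hy, rfl⟩, h⟩
    have h1 := congrArg norm h
    simp only [norm_smul, norm_eq_of_mem_sphere, mul_one, Real.norm_eq_abs, abs_of_pos hr,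
      abs_of_pos ht.1] at h1
    subst h1
    have h2 : y = circlePoint θ := Subtype.ext (smul_right_injective _ hr.ne' h)
    exact ⟨ht.2, h2 ▸ hy⟩
  · rintro ⟨h1, h2⟩
    exact ⟨r, ⟨hr, h1⟩, _, ⟨_, h2, rfl⟩, rfl⟩

/-- Polar coordinates are injective and measurable on a standard Borel space, so images of Borel
sets are Borel. -/
theorem measurableSet_Ioo_smul {d : ℕ} {s : Set (UnitSphere d)} (hs : MeasurableSet s) :
    MeasurableSet (Ioo (0 : ℝ) 1 • ((↑) '' s : Set (EuclideanSpace ℝ (Fin d)))) := by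
  have : StandardBorelSpace (UnitSphere d) := (isClosed_sphere.measurableSet).standardBorel
  have h : Ioo (0 : ℝ) 1 • ((↑) '' s : Set (EuclideanSpace ℝ (Fin d))) =
      (fun w : ℝ × UnitSphere d => w.1 • (w.2 : EuclideanSpace ℝ (Fin d))) '' (Ioo (0 : ℝ) 1 ×ˢ s) := by
    ext v
    simp only [Set.mem_smul, mem_image, mem_prod, Prod.exists]
    constructor
    · rintro ⟨t, ht, _, ⟨y, hy, rfl⟩, h⟩
      exact ⟨t, y, ⟨ht, hy⟩, h⟩
    · rintro ⟨t, y, ⟨ht, hy⟩, h⟩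
      exact ⟨t, ht, _, ⟨y, hy, rfl⟩, h⟩
  rw [h]
  refine (measurableSet_Ioo.prod hs).image_of_measurable_injOn (by fun_prop) ?_
  rintro ⟨t, x⟩ ⟨ht, -⟩ ⟨t', x'⟩ ⟨ht', -⟩ hxx
  have h1 := congrArg norm hxx
  simp only [norm_smul, norm_eq_of_mem_sphere, mul_one, Real.norm_eq_abs, abs_of_pos ht.1,
    abs_of_pos ht'.1] at h1
  subst h1
  exact Prod.ext rfl (Subtype.ext (smul_right_injective _ ht.1.ne' hxx))

/-- The surface measure of the unit circle is the angular measure. -/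
theorem measurePreserving_circlePoint :
    MeasurePreserving circlePoint (volume.restrict (Ioc (-Real.pi) Real.pi)) (surfaceMeasure 2) := by
  rw [← Measure.restrict_congr_set Ioo_ae_eq_Ioc]
  refine ⟨measurable_circlePoint, ?_⟩
  ext s hs
  have hK := measurableSet_Ioo_smul hs
  rw [Measure.map_apply measurable_circlePoint hs, surfaceMeasure, Measure.toSphere_apply' _ hs,
    ← measurePreserving_planeEquiv.measure_preimage hK.nullMeasurableSet,
    ← lintegral_indicator_one (planeEquiv.measurable hK), ← lintegral_comp_polarCoord_symm]
  have h1 : ∀ w ∈ polarCoord.target, ENNReal.ofReal w.1 • (planeEquiv ⁻¹'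
      (Ioo (0 : ℝ) 1 • ((↑) '' s : Set (EuclideanSpace ℝ (Fin 2))))).indicator
        (1 : ℝ × ℝ → ℝ≥0∞) (polarCoord.symm w) =
      (Iio (1 : ℝ)).indicator ENNReal.ofReal w.1 * (circlePoint ⁻¹' s).indicator 1 w.2 := by
    rintro ⟨r, θ⟩ ⟨hr, -⟩
    have h0 : (r * Real.cos θ, r * Real.sin θ) ∈ planeEquiv ⁻¹'
        (Ioo (0 : ℝ) 1 • ((↑) '' s : Set (EuclideanSpace ℝ (Fin 2)))) ↔
          r < 1 ∧ circlePoint θ ∈ s := smul_circlePoint_mem_smul_iff hr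
    classical
    simp only [indicator_apply, polarCoord_symm_apply, h0, mem_preimage, mem_Iio, smul_eq_mul]
    by_cases a : r < 1 <;> by_cases b : circlePoint θ ∈ s <;> simp [a, b]
  rw [setLIntegral_congr_fun polarCoord.open_target.measurableSet h1, polarCoord_target,
    Measure.volume_eq_prod, ← Measure.prod_restrict,
    lintegral_prod_mul (ENNReal.measurable_ofReal.indicator measurableSet_Iio).aemeasurable
      (measurable_one.indicator (measurable_circlePoint hs)).aemeasurable,
    lintegral_indicator_one (measurable_circlePoint hs), lintegral_indicator measurableSet_Iio,
    Measure.restrict_restrict measurableSet_Iio, Iio_inter_Ioi, ← mul_assoc]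
  have h2 : ∫⁻ r in Ioo (0 : ℝ) 1, ENNReal.ofReal r = ENNReal.ofReal (1 / 2) := by
    rw [← ofReal_integral_eq_lintegral_ofReal, ← integral_Ioc_eq_integral_Ioo,
      ← intervalIntegral.integral_of_le zero_le_one, integral_id]
    · norm_num
    · exact (continuous_id.integrableOn_Icc (a := (0:ℝ)) (b := 1)).mono_set Ioo_subset_Icc_self
    · exact (ae_restrict_mem measurableSet_Ioo).mono fun r hr => hr.1.le
  -- The dimension factor 2 in `toSphere` cancels the radial integral 1/2.
  have h3 : ((Module.finrank ℝ (EuclideanSpace ℝ (Fin 2)) : ℕ) : ℝ≥0∞) * ENNReal.ofReal (1 / 2) = 1 := by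
    rw [finrank_euclideanSpace_fin, ← ENNReal.ofReal_natCast, ← ENNReal.ofReal_mul (by norm_num)]
    norm_num
  rw [h2, h3, one_mul]

/-- The preimage of a null set under a continuously differentiable map whose derivative is almost
everywhere invertible is a null set. -/
theorem measure_preimage_eq_zero_of_ae_det_ne_zero {V : Type*} [NormedAddCommGroup V]
    [NormedSpace ℝ V] [FiniteDimensional ℝ V] [MeasurableSpace V] [BorelSpace V] (μ : Measure V)
    [μ.IsAddHaarMeasure] {f : V → V} (hf : ContDiff ℝ 1 f) {W : Set V} (hW : MeasurableSet W)
    (h0 : μ W = 0) (hdet : ∀ᵐ x ∂μ, (fderiv ℝ f x).det ≠ 0) : μ (f ⁻¹' W) = 0 := by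
  -- Near a point with invertible derivative f is injective, and the change of variables formula
  -- gives ∫ |det| = 0 over the preimage of `W`.
  have h1 : μ (f ⁻¹' W ∩ {x | (fderiv ℝ f x).det ≠ 0}) = 0 := by
    refine measure_null_of_locally_null _ fun x hx => ?_
    have hs : HasStrictFDerivAt f (((fderiv ℝ f x).toContinuousLinearEquivOfDetNeZero hx.2 : V ≃L[ℝ] V) :
        V →L[ℝ] V) x := by
      rw [ContinuousLinearMap.coe_toContinuousLinearEquivOfDetNeZero]
      exact hf.contDiffAt.hasStrictFDerivAt one_ne_zero
    let e := hs.toOpenPartialHomeomorph f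
    have hx' : e.source ∈ 𝓝 x := e.open_source.mem_nhds hs.mem_toOpenPartialHomeomorph_source
    refine ⟨_, inter_mem_nhdsWithin _ hx', ?_⟩
    have hm : MeasurableSet (e.source ∩ f ⁻¹' W) :=
      e.open_source.measurableSet.inter (hf.continuous.measurable hW)
    have h2 := lintegral_abs_det_fderiv_eq_addHaar_image μ hm
      (fun y _ => (hf.differentiable one_ne_zero y).hasFDerivAt.hasFDerivWithinAt)
      (e.injOn.mono inter_subset_left)
    have h3 : Measurable fun y => ENNReal.ofReal |(fderiv ℝ f y).det| :=
      ENNReal.measurable_ofReal.comp (ContinuousLinearMap.continuous_det.comp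
        (hf.continuous_fderiv one_ne_zero)).abs.measurable
    rw [measure_mono_null (image_subset_iff.2 inter_subset_right) h0, lintegral_eq_zero_iff h3] at h2
    rw [EventuallyEq, ae_restrict_iff' hm] at h2
    refine measure_mono_null (fun y hy => ?_) (measure_eq_zero_iff_ae_notMem.2 ?_ :
      μ {y | ¬ (y ∈ e.source ∩ f ⁻¹' W → ENNReal.ofReal |(fderiv ℝ f y).det| = 0)} = 0)
    · simp only [mem_ofPred_eq, Classical.not_imp]
      refine ⟨⟨hy.2, hy.1.1⟩, ?_⟩
      rw [ENNReal.ofReal_eq_zero, not_le]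
      exact abs_pos.2 hy.1.2
    · filter_upwards [h2] with y hy h
      exact h hy
  refine measure_mono_null (fun x hx => ?_) (measure_union_null h1 (ae_iff.1 hdet))
  by_cases h : (fderiv ℝ f x).det = 0
  · exact Or.inr (not_not.2 h)
  · exact Or.inl ⟨hx, h⟩

/-- The sum of the points of the unit circle with angles `w.1` and `w.2`, in coordinates. -/
noncomputable def angleSum (w : ℝ × ℝ) : ℝ × ℝ :=
  (Real.cos w.1 + Real.cos w.2, Real.sin w.1 + Real.sin w.2)

theorem circlePoint_add_circlePoint (a b : ℝ) :
    (circlePoint a : EuclideanSpace ℝ (Fin 2)) + circlePoint b = planeEquiv (angleSum (a, b)) := by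
  rw [coe_circlePoint, coe_circlePoint, ← planeEquiv_add]
  rfl

theorem contDiff_angleSum : ContDiff ℝ 1 angleSum := by
  unfold angleSum
  fun_prop

theorem det_fderiv_angleSum (w : ℝ × ℝ) :
    (fderiv ℝ angleSum w).det = Real.sin (w.2 - w.1) := by
  have h : HasFDerivAt angleSum
      (LinearMap.toContinuousLinearMap (Matrix.toLin (Module.Basis.finTwoProd ℝ)
        (Module.Basis.finTwoProd ℝ)
        !![-Real.sin w.1, -Real.sin w.2; Real.cos w.1, Real.cos w.2])) w := by
    unfold angleSum
    rw [Matrix.toLin_finTwoProd_toContinuousLinearMap]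
    convert! HasFDerivAt.prodMk (𝕜 := ℝ)
      (((Real.hasDerivAt_cos w.1).comp_hasFDerivAt w hasFDerivAt_fst).add
        ((Real.hasDerivAt_cos w.2).comp_hasFDerivAt w hasFDerivAt_snd))
      (((Real.hasDerivAt_sin w.1).comp_hasFDerivAt w hasFDerivAt_fst).add
        ((Real.hasDerivAt_sin w.2).comp_hasFDerivAt w hasFDerivAt_snd)) using 2
  rw [h.fderiv, LinearMap.det_toContinuousLinearMap, LinearMap.det_toLin, Matrix.det_fin_two_of,
    Real.sin_sub]
  ring

theorem ae_sin_sub_ne_zero : ∀ᵐ w : ℝ × ℝ, Real.sin (w.2 - w.1) ≠ 0 := by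
  have hm : MeasurableSet {w : ℝ × ℝ | Real.sin (w.2 - w.1) ≠ 0} :=
    (measurableSet_eq_fun (by fun_prop) measurable_const).compl
  refine (Measure.ae_prod_iff_ae_ae hm).2 (Eventually.of_forall fun a => ?_)
  have hc : {b : ℝ | Real.sin (b - a) = 0}.Countable := by
    refine (countable_range fun n : ℤ => a + n * Real.pi).mono fun b hb => ?_
    obtain ⟨n, hn⟩ := Real.sin_eq_zero_iff.1 hb
    exact ⟨n, by simp [hn]⟩
  filter_upwards [hc.ae_notMem volume] with b hb using hb

/-- Almost every pair of points of the circle has a generic sum. -/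
theorem quasiMeasurePreserving_add_circle :
    Measure.QuasiMeasurePreserving (fun w : UnitSphere 2 × UnitSphere 2 =>
      (w.1 : EuclideanSpace ℝ (Fin 2)) + w.2) ((surfaceMeasure 2).prod (surfaceMeasure 2))
      volume := by
  have hm : Measurable (fun w : UnitSphere 2 × UnitSphere 2 =>
      (w.1 : EuclideanSpace ℝ (Fin 2)) + w.2) := by fun_prop
  refine ⟨hm, Measure.AbsolutelyContinuous.mk fun s hs h0 => ?_⟩
  rw [Measure.map_apply hm hs, ← (measurePreserving_circlePoint.prod
    measurePreserving_circlePoint).measure_preimage (hm hs).nullMeasurableSet, Measure.prod_restrict]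
  refine measure_mono_null (fun w hw => ?_) (nonpos_iff_eq_zero.1
    ((Measure.restrict_apply_le _ _).trans (measure_preimage_eq_zero_of_ae_det_ne_zero volume
      contDiff_angleSum (planeEquiv.measurable hs) ?_ ?_).le))
  · simpa [circlePoint_add_circlePoint] using hw
  · rwa [measurePreserving_planeEquiv.measure_preimage hs.nullMeasurableSet]
  · filter_upwards [ae_sin_sub_ne_zero] with w hw
    rwa [det_fderiv_angleSum]

/-- A property of almost all pairs of points of the circle holds for the summands in almost every
decomposition of a point of the disc as a sum of two points of the circle. -/
theorem ae_of_add_eq_circle {ρ : UnitSphere 2 × UnitSphere 2 → Prop}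
    (h : ∀ᵐ w ∂(surfaceMeasure 2).prod (surfaceMeasure 2), ρ w)
    {x y : EuclideanSpace ℝ (Fin 2) → UnitSphere 2}
    (hxy : ∀ v, ‖v‖ ≤ 2 → (x v : EuclideanSpace ℝ (Fin 2)) + y v = v) :
    ∀ᵐ v : EuclideanSpace ℝ (Fin 2), ‖v‖ ≤ 2 → ρ (x v, y v) := by
  have h1 := (measurePreserving_circlePoint.prod
    measurePreserving_circlePoint).quasiMeasurePreserving.ae h
  rw [Measure.prod_restrict, ae_restrict_iff' (measurableSet_Ioc.prod measurableSet_Ioc)] at h1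
  -- Differentiable maps carry null sets to null sets, so the sums of exceptional pairs form a null
  -- set, whichever decomposition is chosen.
  have h2 := addHaar_image_eq_zero_of_differentiableOn_of_addHaar_eq_zero volume
    (contDiff_angleSum.differentiable one_ne_zero).differentiableOn (ae_iff.1 h1)
  have h3 := (measurePreserving_planeEquiv.symm planeEquiv).quasiMeasurePreserving.ae
    (measure_eq_zero_iff_ae_notMem.1 h2)
  filter_upwards [h3] with v hv hv2
  by_contra hρ
  obtain ⟨a, ha, hax⟩ := exists_circlePoint_eq (x v)
  obtain ⟨b, hb, hby⟩ := exists_circlePoint_eq (y v)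
  refine hv ⟨(a, b), fun hab => ?_, ?_⟩
  · have := hab ⟨ha, hb⟩
    simp only [Prod.map] at this
    rw [hax, hby] at this
    exact hρ this
  · rw [MeasurableEquiv.eq_symm_apply, ← circlePoint_add_circlePoint, hax, hby, hxy v hv2]

theorem ae_of_sub_eq_circle {ρ : UnitSphere 2 × UnitSphere 2 → Prop}
    (h : ∀ᵐ w ∂(surfaceMeasure 2).prod (surfaceMeasure 2), ρ w)
    {x y : EuclideanSpace ℝ (Fin 2) → UnitSphere 2}
    (hxy : ∀ v, ‖v‖ ≤ 2 → (x v : EuclideanSpace ℝ (Fin 2)) - y v = v) :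
    ∀ᵐ v : EuclideanSpace ℝ (Fin 2), ‖v‖ ≤ 2 → ρ (x v, y v) := by
  let A : EuclideanSpace ℝ (Fin 2) ≃ₗᵢ[ℝ] EuclideanSpace ℝ (Fin 2) := LinearIsometryEquiv.neg ℝ
  have h1 := ((MeasurePreserving.id (surfaceMeasure 2)).prod
    (measurePreserving_sphereMap A)).quasiMeasurePreserving.ae h
  have h2 := ae_of_add_eq_circle h1 (x := x) (y := fun v => sphereMap A (y v)) fun v hv => by
    rw [coe_sphereMap, LinearIsometryEquiv.coe_neg, ← sub_eq_add_neg, hxy v hv]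
  filter_upwards [h2] with v hv hv2
  have := hv hv2
  have e : sphereMap A (sphereMap A (y v)) = y v := Subtype.ext (by simp [A])
  simpa only [Prod.map, id, e] using this

/-- The boundary sphere is null, so smaller balls exhaust the ball; the margin δ leaves room for
translations. -/
theorem exists_radius_not_ae_eq_zero {V : Type*} [NormedAddCommGroup V] [NormedSpace ℝ V]
    [FiniteDimensional ℝ V] [MeasurableSpace V] [BorelSpace V] (μ : Measure V)
    [μ.IsAddHaarMeasure] {P : V → ℂ} {R : ℝ} (hR : R ≠ 0)
    (h : ¬ ∀ᵐ s ∂μ, ‖s‖ ≤ R → P s = 0) : ∃ δ > 0, ¬ ∀ᵐ s ∂μ, ‖s‖ ≤ R - δ → P s = 0 := by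
  by_contra! hc
  refine h ?_
  have h1 : ∀ᵐ s ∂μ, ∀ n : ℕ, ‖s‖ ≤ R - 1 / (n + 1 : ℝ) → P s = 0 :=
    ae_all_iff.2 fun n => hc _ Nat.one_div_pos_of_nat
  filter_upwards [h1, measure_eq_zero_iff_ae_notMem.1 (Measure.addHaar_sphere_of_ne_zero μ 0 hR)]
    with s hs1 hs2 hs
  rw [mem_sphere_zero_iff_norm] at hs2
  obtain ⟨n, hn⟩ := exists_nat_one_div_lt (sub_pos.2 (lt_of_le_of_ne hs hs2))
  exact hs1 n (by linarith)

/-! ### Conclusion in dimension two -/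

/-- In dimension two, a measurable function on the circle for which the third tensor power is a
function of the sum of the variables is zero or an exponential. -/
theorem exists_ae_eq_exp_of_triple {f : UnitSphere 2 → ℂ} (hf : Measurable f)
    {H : EuclideanSpace ℝ (Fin 2) → ℂ}
    (hH : ∀ᵐ q ∂(((surfaceMeasure 2).prod (surfaceMeasure 2)).prod (surfaceMeasure 2)),
      f q.1.1 * f q.1.2 * f q.2 = H ((q.1.1 : EuclideanSpace ℝ (Fin 2)) + q.1.2 + q.2))
    (hf0 : ¬ ∀ᵐ x ∂surfaceMeasure 2, f x = 0) :
    ∃ (l : EuclideanSpace ℝ (Fin 2) →L[ℝ] ℂ) (c : ℂ), c ≠ 0 ∧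
      ∀ᵐ z : UnitSphere 2 ∂surfaceMeasure 2, f z = c * Complex.exp (l z) := by
  have := preconnectedSpace_unitSphere le_rfl
  have := nonempty_unitSphere (d := 2) le_rfl
  obtain ⟨p, q, hp, hq, hpq⟩ := exists_measurable_chord (d := 2) le_rfl
  let A : EuclideanSpace ℝ (Fin 2) ≃ₗᵢ[ℝ] EuclideanSpace ℝ (Fin 2) := LinearIsometryEquiv.neg ℝ
  let q' : EuclideanSpace ℝ (Fin 2) → UnitSphere 2 := fun v => sphereMap A (q v)
  have hq' : Measurable q' := (continuous_sphereMap A).measurable.comp hq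
  have hpq' : ∀ v, ‖v‖ ≤ 2 → (p v : EuclideanSpace ℝ (Fin 2)) + q' v = v := fun v hv => by
    rw [coe_sphereMap, LinearIsometryEquiv.coe_neg, ← sub_eq_add_neg, hpq v hv]
  let P : EuclideanSpace ℝ (Fin 2) → ℂ := fun s => f (p s) * f (q' s)
  let χ : EuclideanSpace ℝ (Fin 2) → ℂ := fun v => f (p v) / f (q v)
  have hP : Measurable P := (hf.comp hp).mul (hf.comp hq')
  have hχ : Measurable χ := (hf.comp hp).div (hf.comp hq)
  let B := closedBall (0 : EuclideanSpace ℝ (Fin 2)) 2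
  have hB : MeasurableSet B := isClosed_closedBall.measurableSet
  have hqmp : Measure.QuasiMeasurePreserving (fun s => (p s, q' s)) (volume.restrict B)
      ((surfaceMeasure 2).prod (surfaceMeasure 2)) := by
    refine ⟨hp.prodMk hq', Measure.AbsolutelyContinuous.mk fun s hs h0 => ?_⟩
    rw [Measure.map_apply (hp.prodMk hq') hs, measure_eq_zero_iff_ae_notMem, ae_restrict_iff' hB]
    filter_upwards [ae_of_add_eq_circle (measure_eq_zero_iff_ae_notMem.1 h0) hpq'] with v hv hvB
    exact hv (mem_closedBall_zero_iff.1 hvB)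
  have h1 : ∀ᵐ w ∂((volume.restrict B).prod (surfaceMeasure 2)),
      P w.1 * f w.2 = H (w.1 + (w.2 : EuclideanSpace ℝ (Fin 2))) := by
    filter_upwards [(QuasiMeasurePreserving.prodMap hqmp
      (Measure.QuasiMeasurePreserving.id (surfaceMeasure 2))).ae hH,
      Measure.quasiMeasurePreserving_fst.ae (ae_restrict_mem hB)] with w hw hwB
    simpa only [Prod.map, id, hpq' w.1 (mem_closedBall_zero_iff.1 hwB)] using hw
  have h2 : ∀ᵐ z ∂surfaceMeasure 2, ∀ᵐ s : EuclideanSpace ℝ (Fin 2), ‖s‖ ≤ 2 →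
      P s * f z = H (s + (z : EuclideanSpace ℝ (Fin 2))) := by
    filter_upwards [Measure.ae_ae_of_ae_prod (Measure.measurePreserving_swap.quasiMeasurePreserving.ae h1)] with z hz
    rw [ae_restrict_iff' hB] at hz
    filter_upwards [hz] with s hs hs2
    exact hs (mem_closedBall_zero_iff.2 hs2)
  -- Both sides equal H(s + z), where (z, z') = w.
  have h3 : ∀ᵐ w ∂(surfaceMeasure 2).prod (surfaceMeasure 2),
      ∀ᵐ s : EuclideanSpace ℝ (Fin 2), ‖s‖ ≤ 2 →
        ‖s + ((w.1 : EuclideanSpace ℝ (Fin 2)) - w.2)‖ ≤ 2 →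
        P (s + ((w.1 : EuclideanSpace ℝ (Fin 2)) - w.2)) * f w.2 = P s * f w.1 := by
    filter_upwards [Measure.quasiMeasurePreserving_fst.ae h2,
      Measure.quasiMeasurePreserving_snd.ae h2] with w hw1 hw2
    have hw3 := (measurePreserving_add_right (volume : Measure (EuclideanSpace ℝ (Fin 2)))
      ((w.1 : EuclideanSpace ℝ (Fin 2)) - w.2)).quasiMeasurePreserving.ae hw2
    filter_upwards [hw1, hw3] with s hs1 hs3 hs hs'
    rw [hs1 hs, hs3 hs', add_assoc, sub_add_cancel]
  -- Otherwise H(x + y + z) would vanish for almost every triple, and with it f.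
  have h4 : ¬ ∀ᵐ s : EuclideanSpace ℝ (Fin 2), ‖s‖ ≤ 2 → P s = 0 := by
    intro hP0
    have h5 := Measure.ae_ae_of_ae_prod h1
    rw [ae_restrict_iff' hB] at h5
    have h6 : ∀ᵐ w ∂(surfaceMeasure 2).prod (surfaceMeasure 2), f w.1 * f w.2 = 0 := by
      filter_upwards [quasiMeasurePreserving_add_circle.ae h5,
        quasiMeasurePreserving_add_circle.ae hP0, Measure.ae_ae_of_ae_prod hH] with w hw1 hw2 hw3
      have hw : ‖(w.1 : EuclideanSpace ℝ (Fin 2)) + w.2‖ ≤ 2 := by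
        refine (norm_add_le _ _).trans ?_
        rw [norm_eq_of_mem_sphere, norm_eq_of_mem_sphere]
        norm_num
      by_contra hne
      refine hf0 ?_
      filter_upwards [hw1 (mem_closedBall_zero_iff.2 hw), hw3] with z hz1 hz3
      rw [← hz1, hw2 hw, zero_mul] at hz3
      exact (mul_eq_zero.1 hz3).resolve_left hne
    refine hf0 ?_
    filter_upwards [Measure.ae_ae_of_ae_prod h6] with x hx
    by_contra hne
    exact hf0 (hx.mono fun y hy => (mul_eq_zero.1 hy).resolve_left hne)
  obtain ⟨δ, hδ, hPδ⟩ := exists_radius_not_ae_eq_zero volume two_ne_zero h4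
  have h3' := Measure.ae_ae_of_ae_prod
    (Measure.measurePreserving_swap.quasiMeasurePreserving.ae h3)
  have h3'' := Measure.ae_ae_of_ae_prod h3
  -- For |s| ≤ 2 - δ the translate stays in the disc of radius 2. So f(z') = 0 gives P(s)f(z) = 0
  -- there, while P is not almost everywhere zero there.
  have hsupp : ∀ {z z' : UnitSphere 2}, dist z z' < δ →
      (∀ᵐ s : EuclideanSpace ℝ (Fin 2), ‖s‖ ≤ 2 →
        ‖s + ((z : EuclideanSpace ℝ (Fin 2)) - z')‖ ≤ 2 →
        P (s + ((z : EuclideanSpace ℝ (Fin 2)) - z')) * f z' = P s * f z) →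
      f z' = 0 → f z = 0 := by
    intro z z' hzz h hz'
    by_contra hz
    refine hPδ ?_
    rw [Subtype.dist_eq, dist_eq_norm] at hzz
    filter_upwards [h] with s hs hsδ
    have h := hs (by linarith) ((norm_add_le _ _).trans (by linarith))
    rw [hz', mul_zero] at h
    exact (mul_eq_zero.1 h.symm).resolve_right hz
  obtain ⟨c, hc⟩ := ae_eq_const_of_ae_dist_lt (surfaceMeasure 2) (fun z => f z = 0) hδ (by
    filter_upwards [h3', h3''] with z' h1 h2
    filter_upwards [h1, h2] with z hz1 hz2 hzz
    exact propext ⟨hsupp (by rwa [dist_comm]) hz2, hsupp hzz hz1⟩)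
  have hne : ∀ᵐ z ∂surfaceMeasure 2, f z ≠ 0 := by
    by_cases hcT : c
    · exact absurd (hc.mono fun z hz => hz.mpr hcT) hf0
    · exact hc.mono fun z hz h => hcT (hz.mp h)
  have hne2 : ∀ᵐ w ∂(surfaceMeasure 2).prod (surfaceMeasure 2), f w.1 ≠ 0 ∧ f w.2 ≠ 0 :=
    (Measure.quasiMeasurePreserving_fst.ae hne).and (Measure.quasiMeasurePreserving_snd.ae hne)
  have hqne := ae_of_sub_eq_circle hne2 hpq
  have hb : ∀ {v : EuclideanSpace ℝ (Fin 2)}, v ∈ ball (0 : EuclideanSpace ℝ (Fin 2)) 1 → ‖v‖ ≤ 2 :=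
    fun hv => by linarith [mem_ball_zero_iff.1 hv]
  refine exists_ae_eq_exp_of_translation le_rfl hP hχ zero_lt_one ?_ ?_ ?_ hne ?_
  · have hm : MeasurableSet {w : EuclideanSpace ℝ (Fin 2) × EuclideanSpace ℝ (Fin 2) |
        w.1 ∈ ball (0 : EuclideanSpace ℝ (Fin 2)) 1 → w.2 ∈ ball (0 : EuclideanSpace ℝ (Fin 2)) 1 →
        P (w.1 + w.2) = P w.1 * χ w.2} :=
      (measurable_fst measurableSet_ball).imp ((measurable_snd measurableSet_ball).imp
        (measurableSet_eq_fun (by fun_prop) (by fun_prop)))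
    rw [Measure.volume_eq_prod, Measure.ae_prod_iff_ae_ae hm]
    refine (Measure.ae_ae_comm (p := fun s v => s ∈ ball (0 : EuclideanSpace ℝ (Fin 2)) 1 →
      v ∈ ball (0 : EuclideanSpace ℝ (Fin 2)) 1 → P (s + v) = P s * χ v) hm).2 ?_
    filter_upwards [ae_of_sub_eq_circle h3 hpq, hqne] with v hv hv0
    by_cases hv1 : v ∈ ball (0 : EuclideanSpace ℝ (Fin 2)) 1
    swap
    · exact Eventually.of_forall fun s _ h => absurd h hv1
    filter_upwards [hv (hb hv1)] with s hs hs1 _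
    rw [hpq v (hb hv1)] at hs
    have h := hs (hb hs1) ((norm_add_le _ _).trans
      (by linarith [mem_ball_zero_iff.1 hs1, mem_ball_zero_iff.1 hv1]))
    simp only [χ]
    rw [← mul_div_assoc, eq_div_iff (hv0 (hb hv1)).2, h]
  · filter_upwards [ae_of_add_eq_circle hne2 hpq'] with s hs hs1
    exact mul_ne_zero (hs (hb hs1)).1 (hs (hb hs1)).2
  · filter_upwards [hqne] with s hs hs1
    exact div_ne_zero (hs (hb hs1)).1 (hs (hb hs1)).2
  · filter_upwards [h3'] with z' hz'
    filter_upwards [hz'] with z hz hzz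
    filter_upwards [hz] with s hs hs1
    rw [Subtype.dist_eq, dist_eq_norm] at hzz
    exact hs (hb hs1) ((norm_add_le _ _).trans (by
      simp only [Prod.swap]
      linarith [mem_ball_zero_iff.1 hs1]))

/-! ### The main theorem -/

theorem exists_complexDot_eq {d : ℕ} (l : EuclideanSpace ℝ (Fin d) →L[ℝ] ℂ) :
    ∃ ν : Fin d → ℂ, ∀ x, complexDot ν x = l x := by
  refine ⟨fun i => l (EuclideanSpace.single i 1), fun x => ?_⟩
  have hx : x = ∑ i, x i • EuclideanSpace.single i (1 : ℝ) := by
    simpa using ((EuclideanSpace.basisFun (Fin d) ℝ).sum_repr x).symm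
  conv_rhs => rw [hx]
  simp [complexDot, mul_comm]

theorem theorem4 (d k : ℕ) (hd : 2 ≤ d) (hk : 2 ≤ k) (hdk : (d, k) ≠ (2, 2))
    (f : Fin k → UnitSphere d → ℂ)
    (hf : ∀ j, AEMeasurable (f j) (surfaceMeasure d))
    (h : EuclideanSpace ℝ (Fin d) → ℂ)
    (hh : AEMeasurable h
      ((volume : Measure (EuclideanSpace ℝ (Fin d))).restrict (closedBall 0 (k : ℝ))))
    (heq : ∀ᵐ ζ : Fin k → UnitSphere d ∂(Measure.pi fun _ : Fin k => surfaceMeasure d),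
      ∏ j, f j (ζ j) = h (∑ j, (ζ j : EuclideanSpace ℝ (Fin d)))) :
    (∃ (c : Fin k → ℂ) (ν : Fin d → ℂ), (∀ j, c j ≠ 0) ∧
      ∀ j, ∀ᵐ ζ ∂(surfaceMeasure d),
        f j ζ = c j * Complex.exp (complexDot ν (ζ : EuclideanSpace ℝ (Fin d)))) ∨
    (∃ j, ∀ᵐ ζ ∂(surfaceMeasure d), f j ζ = 0) := by
  by_cases hex : ∃ j, ∀ᵐ ζ ∂(surfaceMeasure d), f j ζ = 0
  · exact Or.inr hex
  left
  push Not at hex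
  obtain ⟨n, rfl⟩ : ∃ n, k = n + 1 := ⟨k - 1, by omega⟩
  obtain ⟨hprop, ⟨H₂, hH₂⟩, hH₃⟩ := exists_proportional_of_prod_eq (surfaceMeasure d)
    (fun x : UnitSphere d => (x : EuclideanSpace ℝ (Fin d))) (by omega) f
    (fun j => not_eventually.2 (hex j)) h heq
  have hg := (hf 0).ae_eq_mk
  have hgm := (hf 0).measurable_mk
  set g := (hf 0).mk (f 0)
  have hg0 : ¬ ∀ᵐ x ∂surfaceMeasure d, g x = 0 := fun h0 =>
    not_eventually.2 (hex 0) (by filter_upwards [hg, h0] with x h1 h2; rw [h1, h2])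
  have key : ∃ (l : EuclideanSpace ℝ (Fin d) →L[ℝ] ℂ) (c : ℂ), c ≠ 0 ∧
      ∀ᵐ z : UnitSphere d ∂surfaceMeasure d, g z = c * Complex.exp (l z) := by
    rcases hd.lt_or_eq with hd3 | rfl
    -- For d ≥ 3 the pair equation suffices for every k; for d = 2 the excluded case guarantees a
    -- third factor.
    · refine exists_ae_eq_exp_of_pair hd3 hgm (H := H₂) ?_ hg0
      filter_upwards [hH₂, Measure.quasiMeasurePreserving_fst.ae hg,
        Measure.quasiMeasurePreserving_snd.ae hg] with q h1 h2 h3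
      rw [← h2, ← h3, h1]
    · obtain ⟨H₃, hH₃⟩ := hH₃ (by
        by_contra hn
        exact hdk (by rw [show n = 1 by omega]))
      refine exists_ae_eq_exp_of_triple hgm (H := H₃) ?_ hg0
      filter_upwards [hH₃, Measure.quasiMeasurePreserving_fst.ae
          (Measure.quasiMeasurePreserving_fst.ae hg),
        Measure.quasiMeasurePreserving_fst.ae (Measure.quasiMeasurePreserving_snd.ae hg),
        Measure.quasiMeasurePreserving_snd.ae hg] with q h1 h2 h3 h4
      rw [← h2, ← h3, ← h4, h1]
  obtain ⟨l, c, hc, hl⟩ := key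
  obtain ⟨ν, hν⟩ := exists_complexDot_eq l
  choose a ha hfa using hprop
  refine ⟨fun j => a j * c, ν, fun j => mul_ne_zero (ha j) hc, fun j => ?_⟩
  filter_upwards [hfa j, hg, hl] with z h1 h2 h3
  rw [h1, h2, h3, hν, mul_assoc]
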